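/- Let $\kappa\ge 1$ and $n\ge 2$ be integers. For $\sigma\in SO(\kappa)$ and $x\in\mathbb{R}^{\kappa n}$ let $$R_\sigma(x)=\bigl(\sigma(x_1,\dots,x_\kappa),\dots,\sigma(x_{\kappa(n-1)+1},\dots,x_{\kappa n})\bigr).$$ A convex body (a compact convex set with non-empty interior) $D\subset\mathbb{R}^{\kappa n}$ that is symmetric about the origin, with Minkowski functional $\|\cdot\|_D$, is called $R_\sigma$-invariant if $\|R_\sigma x\|_D=\|x\|_D$ for all $x\in\mathbb{R}^{\kappa n}$ and all $\sigma\in SO(\kappa)$. Let $\sigma_0=I,\sigma_1,\dots,\sigma_{\kappa-1}\in SO(\kappa)$ be an orthogonal sequence of rotations, that is, for every $x\in\mathbb{R}^\kappa$ the vectors $x,\sigma_1x,\dots,\sigma_{\kappa-1}x$ are mutually orthogonal (such sequences exist exactly for $\kappa\in\{1,2,4,8\}$), and for $\xi\in S^{\kappa n-1}$ let $H_\xi$ be the $(\kappa n-\kappa)$-dimensional orthogonal complement of the span of $\xi,R_{\sigma_1}\xi,\dots,R_{\sigma_{\kappa-1}}\xi$. An origin-symmetric convex body $D$ in $\mathbb{R}^{\kappa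 n}$ is called a $\kappa$-intersection body if there is a finite Borel measure $\mu$ on $S^{\kappa n-1}$ such that for every even Schwartz function $\phi$ on $\mathbb{R}^{\kappa n}$ $$\int_{\mathbb{R}^{\kappa n}}\|x\|_D^{-\kappa}\phi(x)\,dx=\int_{S^{\kappa n-1}}\Bigl(\int_0^\infty t^{\kappa-1}\hat\phi(t\xi)\,dt\Bigr)d\mu(\xi),\qquad \hat\phi(\xi)=\int_{\mathbb{R}^{\kappa n}}\phi(x)e^{-i\langle x,\xi\rangle}\,dx.$$ Theorem. The following are equivalent. (a) (The Busemann–Petty problem for $R_\sigma$-invariant bodies has an affirmative answer.) For all $R_\sigma$-invariant origin-symmetric convex bodies $K,L$ in $\mathbb{R}^{\kappa n}$, if $\mathrm{Vol}_{\kappa n-\kappa}(K\cap H_\xi)\le \mathrm{Vol}_{\kappa n-\kappa}(L\cap H_\xi)$ for every $\xi\in S^{\kappa n-1}$, then $\mathrm{Vol}_{\kappa n}(K)\le\mathrm{Vol}_{\kappa n}(L)$. (b) Every $R_\sigma$-invariant origin-symmetric convex body in $\mathbb{R}^{\kappa n}$ is a $\kappa$-intersection body. -/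

import Mathlib

open scoped SchwartzMap

noncomputable section

namespace BusemannPetty

/-- `ℝ^{κn}`, with coordinates grouped into `n` consecutive `κ`-tuples: the coordinate
`x (i, j)` is the `j`-th entry of the `i`-th tuple. -/
abbrev Space (κ n : ℕ) : Type := EuclideanSpace ℝ (Fin n × Fin κ)

/-- `R_σ`: the rotation `σ ∈ SO(κ)` applied to each of the `n` tuples of coordinates of `x`. -/
def blockRotation {κ n : ℕ} (σ : Matrix.specialOrthogonalGroup (Fin κ) ℝ) (x : Space κ n) :
    Space κ n :=
  WithLp.toLp 2 fun p => ((σ : Matrix (Fin κ) (Fin κ) ℝ).mulVec fun j => x (p.1, j)) p.2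

/-- `D` has the `R_σ`-invariance property: its Minkowski functional is unchanged by every `R_σ`,
`σ ∈ SO(κ)`. -/
def IsRotationInvariant {κ n : ℕ} (D : Set (Space κ n)) : Prop :=
  ∀ (σ : Matrix.specialOrthogonalGroup (Fin κ) ℝ) (x : Space κ n),
    gauge D (blockRotation σ x) = gauge D x

/-- Origin symmetric convex bodies (compact, convex, with non-empty interior). -/
structure IsSymmetricConvexBody {E : Type*} [NormedAddCommGroup E] [NormedSpace ℝ E]
    (D : Set E) : Prop where
  isCompact : IsCompact D
  convex : Convex ℝ D
  nonempty_interior : (interior D).Nonempty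
  neg_mem : ∀ x ∈ D, -x ∈ D

/-- An orthogonal sequence `σ_0 = I, σ_1, …, σ_{κ-1}` of rotations of `ℝ^κ`: for every vector `x`
the vectors `x, σ_1 x, …, σ_{κ-1} x` are mutually orthogonal. -/
structure IsOrthogonalSequence {κ : ℕ} [NeZero κ]
    (σ : Fin κ → Matrix.specialOrthogonalGroup (Fin κ) ℝ) : Prop where
  zero_eq_one : σ 0 = 1
  orthogonal : ∀ i j : Fin κ, i ≠ j → ∀ x : Fin κ → ℝ,
    dotProduct ((σ i : Matrix (Fin κ) (Fin κ) ℝ).mulVec x)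
      ((σ j : Matrix (Fin κ) (Fin κ) ℝ).mulVec x) = 0

/-- `H_ξ`: the orthogonal complement of the span of `R_{σ_0} ξ, …, R_{σ_{κ-1}} ξ`. -/
def sectionSubspace {κ n : ℕ} (σ : Fin κ → Matrix.specialOrthogonalGroup (Fin κ) ℝ)
    (ξ : Space κ n) : Submodule ℝ (Space κ n) :=
  (Submodule.span ℝ (Set.range fun j : Fin κ => blockRotation (σ j) ξ))ᗮ

/-- The volume of `D ∩ H`, with respect to the Lebesgue measure of the Euclidean space `H`. -/
def sectionVolume {E : Type*} [NormedAddCommGroup E] [InnerProductSpace ℝ E]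
    [FiniteDimensional ℝ E] [MeasurableSpace E] [BorelSpace E]
    (D : Set E) (H : Submodule ℝ E) : ENNReal :=
  MeasureTheory.volume {y : H | (y : E) ∈ D}

/-- The Fourier transform `∫ φ(x) exp(-i⟨x, ξ⟩) dx`. -/
def fourier {E : Type*} [NormedAddCommGroup E] [InnerProductSpace ℝ E]
    [FiniteDimensional ℝ E] [MeasurableSpace E] [BorelSpace E] (φ : 𝓢(E, ℂ)) (ξ : E) : ℂ :=
  ∫ x : E, Complex.exp (-(Complex.I * ((inner ℝ x ξ : ℝ) : ℂ))) * φ x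

/-- `D` is a `k`-intersection body (for origin symmetric star bodies `D` and `1 ≤ k < dim E`):
there is a finite Borel measure `μ` on the unit sphere such that
`∫ ‖x‖_D^{-k} φ(x) dx = ∫ (∫_0^∞ t^{k-1} φ^(tξ) dt) dμ(ξ)` for all even test functions `φ`. -/
def IsIntersectionBody {E : Type*} [NormedAddCommGroup E] [InnerProductSpace ℝ E]
    [FiniteDimensional ℝ E] [MeasurableSpace E] [BorelSpace E] (k : ℕ) (D : Set E) : Prop :=
  ∃ μ : MeasureTheory.Measure (Metric.sphere (0 : E) 1), MeasureTheory.IsFiniteMeasure μ ∧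
    ∀ φ : 𝓢(E, ℂ), (∀ x, φ (-x) = φ x) →
      ∫ x : E, (((gauge D x ^ k)⁻¹ : ℝ) : ℂ) * φ x =
        ∫ ξ : Metric.sphere (0 : E) 1,
          (∫ t in Set.Ioi (0 : ℝ), ((t ^ (k - 1) : ℝ) : ℂ) * fourier φ (t • (ξ : E))) ∂μ

/-- The Busemann–Petty problem for `R_σ`-invariant origin symmetric convex bodies in `ℝ^{κn}`
has an affirmative answer. -/
def AffirmativeAnswer {κ : ℕ} (n : ℕ)
    (σ : Fin κ → Matrix.specialOrthogonalGroup (Fin κ) ℝ) : Prop :=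
  ∀ K L : Set (Space κ n),
    IsSymmetricConvexBody K → IsRotationInvariant K →
    IsSymmetricConvexBody L → IsRotationInvariant L →
    (∀ ξ : Space κ n, ‖ξ‖ = 1 →
      sectionVolume K (sectionSubspace σ ξ) ≤ sectionVolume L (sectionSubspace σ ξ)) →
    MeasureTheory.volume K ≤ MeasureTheory.volume L

end BusemannPetty

end

/-! Both implications rest on one identity. For an even rotation invariant Schwartz function φ, the
ray integral ∫₀^∞ t^(κ-1) φ^(tξ) dt is a fixed positive multiple of ∫_{H_ξ} φ
(`rayIntegral_fourier_of_invariant`; `integral_rayIntegral_fourier_rot` is the version averaged over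
SO(κ)). Fourier inversion equates the integral of φ^ over H_ξ^⊥ with (2π)^κ ∫_{H_ξ} φ
(`integral_fourier_range`). The unit vectors of H_ξ^⊥ are ∑ a_j R_{σ_j} ξ with |a| = 1, and ∑ a_j
σ_j is a rotation up to sign (`exists_rotation_frameMatrix`), so all rays of H_ξ^⊥ contribute
equally.

(b) ⇒ (a). If K is a κ-intersection body, the identity writes ∫ ‖x‖_K^(-κ) φ as a positive average
of section integrals of φ. Smooth approximations of the indicators of K and L then give ∫_K
‖x‖_K^(-κ) ≤ ∫_L ‖x‖_K^(-κ). Since ‖x‖_K^(-κ) - 1 is nonnegative on K and negative off K, its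
integral over L is at most that over K, and subtraction yields Vol K ≤ Vol L.

(a) ⇒ (b). Let N be the gauge of D. By the M. Riesz extension theorem and Riesz–Markov
(`exists_measure_of_positive`), it suffices that ∫ N^(-κ) φ ≥ 0 whenever the ray integrals of φ^ are
nonnegative. In polar coordinates, after averaging over SO(κ), this says: if f on the sphere has
nonnegative integral over every sphere of H_ξ, then ∫ f N^(-κ) ≥ 0 (`integral_mul_inv_pow_nonneg`).
To prove it, compare the unit balls of P = N + η‖·‖ and Q = P - εg, where g is the degree-one
extension of f P^(κn-κ+1). The convexity of s ↦ s^(-k) (`IsNorm.measureReal_add_le`) shows that the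
sections of Q are at least those of P; the affirmative answer compares the volumes, and the same
convexity inequality with P and Q exchanged gives ∫ g Q^(-κn-1) ≥ 0. Then ε → 0 and η → 0. For Q to
be a norm, C‖·‖ - g must be subadditive for some C. Such g (`IsTame`) are dense by Stone–Weierstrass
(`exists_isTame_near`), and the term η‖·‖ leaves room for them; no smoothness of N is needed. -/

open scoped SchwartzMap

noncomputable section

namespace BusemannPetty

open MeasureTheory Set Metric Filter Topology
open scoped Pointwise

/-! ### Polar coordinates. -/

section Polar

variable {F : Type*} [NormedAddCommGroup F] [NormedSpace ℝ F] [MeasurableSpace F]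
  [FiniteDimensional ℝ F] [BorelSpace F] [Nontrivial F] (μ : Measure F) [μ.IsAddHaarMeasure]
  {X : Type*} [NormedAddCommGroup X] [NormedSpace ℝ X]

/-- Integration in polar coordinates. -/
theorem integral_polar {h : F → X} (hh : Integrable h μ) :
    ∫ x, h x ∂μ = ∫ θ : sphere (0 : F) 1,
      (∫ r in Ioi (0 : ℝ), r ^ (Module.finrank ℝ F - 1) • h (r • (θ : F))) ∂μ.toSphere := by
  set k := Module.finrank ℝ F - 1
  have key := μ.measurePreserving_homeomorphUnitSphereProd
  have emb : MeasurableEmbedding (homeomorphUnitSphereProd F) :=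
    Homeomorph.measurableEmbedding _
  let g : sphere (0 : F) 1 × Ioi (0 : ℝ) → X := fun p => h ((p.2 : ℝ) • (p.1 : F))
  have hg : ∀ x : ({0}ᶜ : Set F), g (homeomorphUnitSphereProd F x) = h x := by
    intro x
    have : ‖(x : F)‖ ≠ 0 := norm_ne_zero_iff.2 x.2
    simp [g, smul_smul, this]
  have h1 : ∫ x, h x ∂μ = ∫ x : ({0}ᶜ : Set F), h x ∂(μ.comap (↑)) := by
    rw [integral_subtype_comap (measurableSet_singleton _).compl h, restrict_compl_singleton]
  have h2 : ∫ x : ({0}ᶜ : Set F), h x ∂(μ.comap (↑)) =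
      ∫ p, g p ∂(μ.toSphere.prod (Measure.volumeIoiPow k)) := by
    rw [← key.integral_comp emb g]
    exact integral_congr_ae (Eventually.of_forall fun x => (hg x).symm)
  have hint : Integrable g (μ.toSphere.prod (Measure.volumeIoiPow k)) := by
    rw [← key.integrable_comp_emb emb]
    have : (g ∘ homeomorphUnitSphereProd F) = h ∘ (Subtype.val : ({0}ᶜ : Set F) → F) :=
      funext hg
    rw [this, ← integrableOn_iff_comap_subtypeVal (measurableSet_singleton _).compl]
    exact hh.integrableOn
  rw [h1, h2, integral_prod g hint]
  refine integral_congr_ae (Eventually.of_forall fun θ => ?_)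
  simp only [g, Measure.volumeIoiPow, ENNReal.ofReal]
  rw [integral_withDensity_eq_integral_smul,
    integral_subtype_comap measurableSet_Ioi
      fun a : ℝ ↦ Real.toNNReal (a ^ k) • h (a • (θ : F)),
    setIntegral_congr_fun measurableSet_Ioi fun x hx ↦ ?_]
  · rw [NNReal.smul_def, Real.coe_toNNReal _ (pow_nonneg hx.out.le _)]
  · exact (measurable_subtype_coe.pow_const _).real_toNNReal

end Polar

/-! ### Integrals of Schwartz functions along rays. -/

section Decay

variable {F : Type*} [NormedAddCommGroup F] [NormedSpace ℝ F]

theorem exists_norm_schwartz_le (φ : 𝓢(F, ℂ)) (k : ℕ) :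
    ∃ C, ∀ x, (1 + ‖x‖) ^ k * ‖φ x‖ ≤ C :=
  ⟨_, fun x => by
    simpa using SchwartzMap.one_add_le_sup_seminorm_apply (𝕜 := ℝ) (m := (k, 0)) le_rfl le_rfl φ x⟩

theorem integrableOn_inv_one_add_sq (c : ℝ) :
    IntegrableOn (fun t : ℝ => c * ((1 + t) ^ 2)⁻¹) (Ioi 0) := by
  apply Integrable.const_mul
  have := integrable_inv_one_add_sq.integrableOn (s := Ioi (0 : ℝ))
  refine this.mono' ?_ ?_
  · exact Measurable.aestronglyMeasurable (by fun_prop)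
  · filter_upwards [ae_restrict_mem measurableSet_Ioi] with t ht
    have ht : 0 < t := ht
    rw [Real.norm_of_nonneg (by positivity)]
    gcongr
    nlinarith

/-- Of the `k + 2` powers of decay, `k` absorb the weight `t ^ k` and two remain for integrability;
the bound is uniform in the direction `x`. -/
theorem norm_pow_mul_schwartz_ray_le {φ : 𝓢(F, ℂ)} {k : ℕ} {C : ℝ}
    (hC : ∀ x, (1 + ‖x‖) ^ (k + 2) * ‖φ x‖ ≤ C) {t : ℝ} (ht : 0 < t) {x : F} (hx : ‖x‖ = 1) :
    ‖((t ^ k : ℝ) : ℂ) * φ (t • x)‖ ≤ C * ((1 + t) ^ 2)⁻¹ := by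
  have := hC (t • x)
  rw [norm_smul, hx, Real.norm_of_nonneg ht.le, mul_one, pow_add, mul_assoc] at this
  rw [← div_eq_mul_inv, le_div_iff₀ (by positivity), norm_mul, Complex.norm_real,
    Real.norm_of_nonneg (by positivity)]
  calc t ^ k * ‖φ (t • x)‖ * (1 + t) ^ 2 = t ^ k * ((1 + t) ^ 2 * ‖φ (t • x)‖) := by ring
    _ ≤ (1 + t) ^ k * ((1 + t) ^ 2 * ‖φ (t • x)‖) := by gcongr; linarith
    _ ≤ C := this

/-- The weighted integral of `φ` along the ray through `x`. -/
def rayIntegral (k : ℕ) (φ : F → ℂ) (x : F) : ℂ :=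
  ∫ t in Ioi (0 : ℝ), ((t ^ k : ℝ) : ℂ) * φ (t • x)

theorem integrableOn_ray (φ : 𝓢(F, ℂ)) (k : ℕ) {x : F} (hx : ‖x‖ = 1) :
    IntegrableOn (fun t : ℝ => ((t ^ k : ℝ) : ℂ) * φ (t • x)) (Ioi 0) := by
  obtain ⟨C, hC⟩ := exists_norm_schwartz_le φ (k + 2)
  refine (integrableOn_inv_one_add_sq C).mono' ?_ ?_
  · have : Continuous fun t : ℝ => ((t ^ k : ℝ) : ℂ) * φ (t • x) := by
      have := φ.continuous; fun_prop
    exact this.aestronglyMeasurable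
  · filter_upwards [ae_restrict_mem measurableSet_Ioi] with t ht
    exact norm_pow_mul_schwartz_ray_le hC ht hx

theorem continuous_rayIntegral (φ : 𝓢(F, ℂ)) (k : ℕ) :
    Continuous fun θ : sphere (0 : F) 1 => rayIntegral k φ θ := by
  obtain ⟨C, hC⟩ := exists_norm_schwartz_le φ (k + 2)
  have hφ := φ.continuous
  refine continuous_of_dominated (bound := fun t => C * ((1 + t) ^ 2)⁻¹) ?_ ?_
    (integrableOn_inv_one_add_sq C) ?_
  · intro θ
    exact (integrableOn_ray φ k (by simp)).aestronglyMeasurable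
  · intro θ
    filter_upwards [ae_restrict_mem measurableSet_Ioi] with t ht
    exact norm_pow_mul_schwartz_ray_le hC ht (by simp)
  · refine Eventually.of_forall fun t => ?_
    fun_prop

end Decay

/-! ### The Fourier transform with kernel exp(-i⟨x, ξ⟩). -/

section FourierTransform

variable {E : Type*} [NormedAddCommGroup E] [InnerProductSpace ℝ E]
  [FiniteDimensional ℝ E] [MeasurableSpace E] [BorelSpace E]

open scoped FourierTransform

/-- The kernel of `𝓕` is exp(-2πi⟨x, ξ⟩). This rescaling is the source of the powers of 2π below. -/
theorem fourier_eq (φ : 𝓢(E, ℂ)) (ξ : E) : fourier φ ξ = 𝓕 φ ((2 * Real.pi)⁻¹ • ξ) := by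
  rw [SchwartzMap.fourier_coe, Real.fourier_eq', fourier]
  refine integral_congr_ae (Eventually.of_forall fun x => ?_)
  have : Real.pi ≠ 0 := Real.pi_ne_zero
  simp only [smul_eq_mul, inner_smul_right]
  congr 2
  push_cast
  have : (Real.pi : ℂ) ≠ 0 := by exact_mod_cast this
  field_simp

/-- The non-unitary Fourier transform `fourier φ` as a Schwartz function. -/
def fourierSchwartz (φ : 𝓢(E, ℂ)) : 𝓢(E, ℂ) :=
  SchwartzMap.compCLMOfContinuousLinearEquiv ℂ
    (ContinuousLinearEquiv.smulLeft (Units.mk0 ((2 * Real.pi)⁻¹ : ℝ) (by positivity)))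
    (𝓕 φ)

theorem fourierSchwartz_apply (φ : 𝓢(E, ℂ)) (ξ : E) : fourierSchwartz φ ξ = fourier φ ξ := by
  rw [fourier_eq]; rfl

end FourierTransform

/-! ### Fourier inversion on a subspace. -/

theorem norm_orthogonal_le_norm_add {E W : Type*} [NormedAddCommGroup E] [InnerProductSpace ℝ E]
    [NormedAddCommGroup W] [InnerProductSpace ℝ W] (j : W →ₗᵢ[ℝ] E) (a : W)
    (h : (LinearMap.range j.toLinearMap)ᗮ) : ‖h‖ ≤ ‖j a + (h : E)‖ := by
  have h0 : inner ℝ (j a) (h : E) = 0 := h.2 (j a) ⟨a, rfl⟩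
  have := norm_add_sq_eq_norm_sq_add_norm_sq_of_inner_eq_zero (j a) (h : E) h0
  rw [Submodule.coe_norm]
  nlinarith [norm_nonneg (j a), norm_nonneg (h : E), norm_nonneg (j a + (h : E))]

theorem continuous_integral_fiber {E W : Type*} [NormedAddCommGroup E] [InnerProductSpace ℝ E]
    [FiniteDimensional ℝ E] [MeasurableSpace E] [BorelSpace E]
    [NormedAddCommGroup W] [InnerProductSpace ℝ W] (φ : 𝓢(E, ℂ)) (j : W →ₗᵢ[ℝ] E) :
    Continuous fun a : W => ∫ h : (LinearMap.range j.toLinearMap)ᗮ, φ (j a + h) := by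
  set H := (LinearMap.range j.toLinearMap)ᗮ
  have hφ := φ.continuous
  have hj := j.continuous
  -- Decay of order dim H + 1 is integrable on H, and ‖h‖ ≤ ‖j a + h‖ makes the majorant independent
  -- of `a`.
  set k := Module.finrank ℝ H + 1
  obtain ⟨C, hC⟩ := exists_norm_schwartz_le φ k
  refine continuous_of_dominated (bound := fun h : H => C * (1 + ‖h‖) ^ (-(k : ℝ))) ?_ ?_ ?_ ?_
  · intro a
    have : Continuous fun h : H => φ (j a + h) := by fun_prop
    exact this.aestronglyMeasurable
  · refine fun a => Eventually.of_forall fun h => ?_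
    have h1 := hC (j a + h)
    have h2 := norm_orthogonal_le_norm_add j a h
    rw [Real.rpow_neg (by positivity), ← div_eq_mul_inv, le_div_iff₀ (by positivity),
      Real.rpow_natCast, mul_comm]
    exact le_trans (by gcongr) h1
  · exact (integrable_one_add_norm (by simp [k])).const_mul C
  · refine Eventually.of_forall fun h => ?_
    fun_prop

section FourierSection

variable {E : Type*} [NormedAddCommGroup E] [InnerProductSpace ℝ E]
  [FiniteDimensional ℝ E] [MeasurableSpace E] [BorelSpace E]
  {W : Type*} [NormedAddCommGroup W] [InnerProductSpace ℝ W]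
  [FiniteDimensional ℝ W] [MeasurableSpace W] [BorelSpace W]

open scoped FourierTransform

theorem fourier_comp_isometry (φ ψ : 𝓢(E, ℂ)) (R : E ≃ₗᵢ[ℝ] E) (h : ∀ x, ψ x = φ (R x)) (ξ : E) :
    fourier ψ ξ = fourier φ (R ξ) := by
  unfold fourier
  rw [← R.measurePreserving.integral_comp R.toHomeomorph.measurableEmbedding
    (fun x => Complex.exp (-(Complex.I * ((inner ℝ x (R ξ) : ℝ) : ℂ))) * φ x)]
  simp [h]

theorem fourier_neg_of_even {φ : 𝓢(E, ℂ)} (h : ∀ x, φ (-x) = φ x) (ξ : E) :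
    fourier φ (-ξ) = fourier φ ξ :=
  (fourier_comp_isometry φ φ (LinearIsometryEquiv.neg ℝ) (fun x => (h x).symm) ξ).symm

/-- Lebesgue measure on `E` is the product of the Lebesgue measures on the image of an isometric
embedding and on its orthogonal complement. -/
theorem measurePreserving_add_orthogonal (j : W →ₗᵢ[ℝ] E) :
    MeasurePreserving (fun p : W × (LinearMap.range j.toLinearMap)ᗮ => j p.1 + (p.2 : E)) := by
  set V := LinearMap.range j.toLinearMap
  have h1 : MeasurePreserving (Prod.map j.equivRange id : W × Vᗮ → V × Vᗮ) :=
    j.equivRange.measurePreserving.prod (MeasurePreserving.id _)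
  have h2 := WithLp.volume_preserving_toLp V Vᗮ
  have h3 := V.orthogonalDecomposition.symm.measurePreserving
  convert! h3.comp (h2.comp h1) using 1

/-- The integral of `φ^` over the image of an isometric embedding is a multiple of the
integral of `φ` over the orthogonal complement of that image. -/
theorem integral_fourier_range (φ : 𝓢(E, ℂ)) (j : W →ₗᵢ[ℝ] E) :
    ∫ a : W, fourier φ (j a) =
      ((2 * Real.pi) ^ Module.finrank ℝ W : ℝ) *
        ∫ h : (LinearMap.range j.toLinearMap)ᗮ, φ h := by
  set H := (LinearMap.range j.toLinearMap)ᗮ with hH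
  have mp := measurePreserving_add_orthogonal j
  have hj := j.continuous
  have mono : Function.Injective (fun p : W × H => j p.1 + (p.2 : E)) := by
    rintro ⟨a, h⟩ ⟨b, h'⟩ hab
    have hab : j a + (h : E) = j b + h' := hab
    have h1 := norm_orthogonal_le_norm_add j (a - b) (h - h')
    have h2 : j (a - b) + ((h - h' : H) : E) = 0 := by
      simp only [map_sub, Submodule.coe_sub]
      rw [sub_add_sub_comm, hab, sub_self]
    rw [h2, norm_zero] at h1
    have h3 : h = h' := sub_eq_zero.1 (norm_le_zero_iff.1 h1)
    subst h3
    have : a = b := j.injective (by simpa using hab)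
    rw [this]
  have emb : MeasurableEmbedding (fun p : W × H => j p.1 + (p.2 : E)) :=
    Continuous.measurableEmbedding (by fun_prop) mono
  set ψ : W → ℂ := fun a => ∫ h : H, φ (j a + h) with hψ
  have hψc : Continuous ψ := continuous_integral_fiber φ j
  have hint : Integrable (fun p : W × H => φ (j p.1 + (p.2 : E))) (volume.prod volume) :=
    (mp.integrable_comp_emb emb).2 φ.integrable
  have hψi : Integrable ψ := hint.integral_prod_left
  -- Fourier slice theorem: `ψ` integrates `φ` over the fibres, and the character of frequency `j b`
  -- is constant on each fibre because h ⟂ j b.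
  have hF : ∀ b, 𝓕 ψ b = 𝓕 φ (j b) := by
    intro b
    rw [SchwartzMap.fourier_coe, Real.fourier_eq', Real.fourier_eq',
      ← mp.integral_comp emb, Measure.volume_eq_prod, integral_prod]
    · refine integral_congr_ae (Eventually.of_forall fun a => ?_)
      simp only [hψ, smul_eq_mul]
      rw [← integral_const_mul]
      refine integral_congr_ae (Eventually.of_forall fun h => ?_)
      have h0 : inner ℝ (h : E) (j b) = 0 := by
        rw [real_inner_comm]; exact h.2 (j b) ⟨b, rfl⟩
      simp only [inner_add_left, h0, add_zero, LinearIsometry.inner_map_map]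
    · refine hint.norm.mono' ?_ (Eventually.of_forall fun p => ?_)
      · refine Continuous.aestronglyMeasurable ?_
        have := φ.continuous
        fun_prop
      · rw [norm_smul]
        simp [Complex.norm_exp]
  have hFi : Integrable (𝓕 ψ) := by
    have h1 := (SchwartzMap.compCLMOfAntilipschitz (K := 1) ℝ
      (j.toContinuousLinearMap.hasTemperateGrowth) j.antilipschitz (𝓕 φ)).integrable (μ := volume)
    refine h1.congr (Eventually.of_forall fun b => ?_)
    rw [hF]; rfl
  -- Inversion at the origin, where ψ(0) = ∫_H φ. Rescaling the frequency variable in `W` then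
  -- produces (2π)^(dim W).
  have inv := hψi.fourierInv_fourier_eq hFi (v := 0) hψc.continuousAt
  rw [Real.fourierInv_eq'] at inv
  have e1 : ψ 0 = ∫ h : H, φ h := by simp [hψ]
  have e2 : ∫ b, 𝓕 φ (j b) = ψ 0 := by
    rw [← inv]
    refine integral_congr_ae (Eventually.of_forall fun b => ?_)
    simp [hF]
  have e3 : ∀ a, fourier φ (j a) = 𝓕 φ (j ((2 * Real.pi)⁻¹ • a)) := by
    intro a; rw [fourier_eq, j.map_smul]
  simp_rw [e3]
  rw [Measure.integral_comp_smul volume (fun a => 𝓕 φ (j a)), e2, e1]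
  have : 0 < Real.pi := Real.pi_pos
  rw [inv_pow, inv_inv, abs_of_pos (by positivity), Complex.real_smul]

end FourierSection

/-! ### The compact group SO(κ). -/

/-- The group `SO(κ)`. -/
abbrev SO (κ : ℕ) : Type := Matrix.specialOrthogonalGroup (Fin κ) ℝ

namespace SO

variable {κ : ℕ}

theorem transpose_mul_self (τ : SO κ) : (τ : Matrix (Fin κ) (Fin κ) ℝ).transpose * τ.1 = 1 :=
  (Matrix.mem_orthogonalGroup_iff' _ _).1 (Matrix.mem_specialOrthogonalGroup_iff.1 τ.2).1

instance : IsTopologicalGroup (SO κ) where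
  continuous_inv := by
    refine Continuous.subtype_mk (f := fun τ : SO κ => τ.1.transpose) ?_ _
    exact continuous_subtype_val.matrix_transpose

instance : CompactSpace (SO κ) := by
  refine isCompact_iff_compactSpace.1 ?_
  refine IsCompact.of_isClosed_subset
    (isCompact_univ_pi fun _ => isCompact_univ_pi fun _ => isCompact_Icc (a := (-1 : ℝ)) (b := 1))
    ?_ ?_
  · have : ((Matrix.specialOrthogonalGroup (Fin κ) ℝ : Set (Matrix (Fin κ) (Fin κ) ℝ))) =
        {A | A.transpose * A = 1} ∩ {A | A.det = 1} := by
      ext A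
      simp only [SetLike.mem_coe, Matrix.mem_specialOrthogonalGroup_iff,
        Matrix.mem_orthogonalGroup_iff', mem_inter_iff, mem_ofPred_eq]
    rw [this]
    refine (isClosed_eq ?_ continuous_const).inter (isClosed_eq ?_ continuous_const)
    · fun_prop
    · exact continuous_id.matrix_det
  · intro A hA i _ j _
    have h1 := (Matrix.mem_orthogonalGroup_iff' _ _).1 (Matrix.mem_specialOrthogonalGroup_iff.1 hA).1
    have h2 : ∑ k, A k j * A k j = 1 := by
      simpa [Matrix.mul_apply] using congrFun (congrFun h1 j) j
    have h3 : A i j * A i j ≤ ∑ k, A k j * A k j :=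
      Finset.single_le_sum (f := fun k => A k j * A k j) (fun k _ => mul_self_nonneg _)
        (Finset.mem_univ i)
    rw [h2] at h3
    exact ⟨by nlinarith, by nlinarith⟩

instance : MeasurableSpace (SO κ) := borel _

instance : BorelSpace (SO κ) := ⟨rfl⟩

/-- The right-invariant probability measure on `SO(κ)`. -/
def haar (κ : ℕ) : Measure (SO κ) :=
  (Measure.haarMeasure ⟨⟨univ, isCompact_univ⟩, by simp⟩).inv

instance : (haar κ).IsMulRightInvariant := by
  unfold haar; infer_instance

instance : IsProbabilityMeasure (haar κ) where
  measure_univ := by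
    rw [haar, Measure.inv_apply, inv_univ]
    exact Measure.haarMeasure_self

end SO

/-! ### The blockwise action of matrices. -/

section Rotation

variable {κ n : ℕ}

/-- The action of a `κ × κ` matrix on each of the `n` tuples of coordinates. -/
def blockMap (n : ℕ) (A : Matrix (Fin κ) (Fin κ) ℝ) : Space κ n →ₗ[ℝ] Space κ n where
  toFun x := WithLp.toLp 2 fun p => (A.mulVec fun j => x (p.1, j)) p.2
  map_add' x y := by
    ext p
    simp only [PiLp.add_apply]
    exact congrFun (Matrix.mulVec_add A (fun j => x (p.1, j)) (fun j => y (p.1, j))) p.2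
  map_smul' c x := by
    ext p
    simp only [PiLp.smul_apply, RingHom.id_apply]
    exact congrFun (Matrix.mulVec_smul A c (fun j => x (p.1, j))) p.2

theorem blockMap_apply (A : Matrix (Fin κ) (Fin κ) ℝ) (x : Space κ n) (p : Fin n × Fin κ) :
    blockMap n A x p = (A.mulVec fun j => x (p.1, j)) p.2 := rfl

theorem blockMap_mul (A B : Matrix (Fin κ) (Fin κ) ℝ) (x : Space κ n) :
    blockMap n (A * B) x = blockMap n A (blockMap n B x) := by
  ext p
  simp only [blockMap_apply, ← Matrix.mulVec_mulVec]

theorem blockMap_one (x : Space κ n) : blockMap n 1 x = x := by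
  ext p; simp [blockMap_apply]

theorem blockMap_neg (A : Matrix (Fin κ) (Fin κ) ℝ) (x : Space κ n) :
    blockMap n (-A) x = -blockMap n A x := by
  ext p; simp [blockMap_apply, Matrix.neg_mulVec]

theorem blockMap_sum {ι : Type*} (s : Finset ι) (A : ι → Matrix (Fin κ) (Fin κ) ℝ)
    (x : Space κ n) : blockMap n (∑ i ∈ s, A i) x = ∑ i ∈ s, blockMap n (A i) x := by
  ext p; simp [blockMap_apply, Matrix.sum_mulVec]

theorem blockMap_smul (c : ℝ) (A : Matrix (Fin κ) (Fin κ) ℝ) (x : Space κ n) :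
    blockMap n (c • A) x = c • blockMap n A x := by
  ext p; simp [blockMap_apply, Matrix.smul_mulVec]

theorem inner_blockMap (A B : Matrix (Fin κ) (Fin κ) ℝ) (x y : Space κ n) :
    inner ℝ (blockMap n A x) (blockMap n B y) =
      ∑ i, dotProduct (A.mulVec fun j => x (i, j)) (B.mulVec fun j => y (i, j)) := by
  simp only [PiLp.inner_apply, Fintype.sum_prod_type, dotProduct, blockMap_apply, RCLike.inner_apply,
    conj_trivial]
  refine Finset.sum_congr rfl fun i _ => Finset.sum_congr rfl fun j _ => mul_comm _ _

theorem norm_blockMap {A : Matrix (Fin κ) (Fin κ) ℝ} (hA : A.transpose * A = 1) (x : Space κ n) :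
    ‖blockMap n A x‖ = ‖x‖ := by
  have h : inner ℝ (blockMap n A x) (blockMap n A x) = inner ℝ x x := by
    conv_rhs => rw [← blockMap_one x]
    simp only [inner_blockMap]
    refine Finset.sum_congr rfl fun i _ => ?_
    rw [Matrix.dotProduct_mulVec, Matrix.vecMul_mulVec, hA, Matrix.vecMul_one, Matrix.one_mulVec]
  rw [real_inner_self_eq_norm_sq, real_inner_self_eq_norm_sq] at h
  exact (sq_eq_sq₀ (norm_nonneg _) (norm_nonneg _)).1 h

/-- `R_τ` as a linear isometry. -/
def rot (n : ℕ) (τ : SO κ) : Space κ n ≃ₗᵢ[ℝ] Space κ n :=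
  LinearIsometry.toLinearIsometryEquiv ⟨blockMap n τ.1, norm_blockMap τ.transpose_mul_self⟩ rfl

theorem rot_eq_blockMap (τ : SO κ) (x : Space κ n) : rot n τ x = blockMap n τ.1 x := rfl

theorem rot_apply (τ : SO κ) (x : Space κ n) : rot n τ x = blockRotation τ x := rfl

theorem rot_mul (τ ρ : SO κ) (x : Space κ n) : rot n (τ * ρ) x = rot n τ (rot n ρ x) :=
  blockMap_mul _ _ _

theorem continuous_rot : Continuous fun p : SO κ × Space κ n => rot n p.1 p.2 := by
  have : Continuous fun p : SO κ × Space κ n =>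
      fun q : Fin n × Fin κ => (p.1.1.mulVec fun j => p.2 (q.1, j)) q.2 := by
    refine continuous_pi fun q => ?_
    simp only [Matrix.mulVec, dotProduct]
    refine continuous_finsetSum _ fun j _ => ?_
    refine Continuous.mul ?_ (by fun_prop)
    exact (continuous_subtype_val.comp continuous_fst).matrix_elem _ _
  exact (PiLp.continuous_toLp 2 _).comp this

theorem continuous_rot_comp {X : Type*} [TopologicalSpace X] {f : X → SO κ} {g : X → Space κ n}
    (hf : Continuous f) (hg : Continuous g) : Continuous fun x => rot n (f x) (g x) := by
  have := Continuous.comp (continuous_rot (κ := κ) (n := n)) (hf.prodMk hg)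
  simpa only [Function.comp_def] using this

attribute [irreducible] rot

end Rotation

/-! ### Combinations of an orthogonal sequence of rotations. -/

section Frame

variable {κ n : ℕ} {σ : Fin κ → SO κ}

/-- The combination `∑ a_j σ_j` of the rotations of an orthogonal sequence. -/
def frameMatrix (σ : Fin κ → SO κ) (a : EuclideanSpace ℝ (Fin κ)) : Matrix (Fin κ) (Fin κ) ℝ :=
  ∑ j, a j • (σ j).1

theorem blockMap_frameMatrix (a : EuclideanSpace ℝ (Fin κ)) (x : Space κ n) :
    blockMap n (frameMatrix σ a) x = ∑ j, a j • rot n (σ j) x := by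
  simp only [frameMatrix, blockMap_sum, blockMap_smul, rot_eq_blockMap]

theorem continuous_frameMatrix : Continuous (frameMatrix σ) := by
  unfold frameMatrix
  fun_prop

variable [NeZero κ]

theorem inner_frame (hσ : IsOrthogonalSequence σ) (x : Space κ n) (i j : Fin κ) :
    inner ℝ (rot n (σ i) x) (rot n (σ j) x) = if i = j then ‖x‖ ^ 2 else 0 := by
  split_ifs with h
  · rw [h, real_inner_self_eq_norm_sq, LinearIsometryEquiv.norm_map]
  · rw [rot_eq_blockMap, rot_eq_blockMap, inner_blockMap]
    exact Finset.sum_eq_zero fun k _ => hσ.orthogonal i j h _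

/-- Pythagoras: the vectors R_{σ_j} x are orthogonal and all of length ‖x‖. Fixing `x` makes the
combination isometric in `a`; fixing a unit `a` makes it isometric in `x`. Both readings are used.
-/
theorem norm_blockMap_frameMatrix (hσ : IsOrthogonalSequence σ) (a : EuclideanSpace ℝ (Fin κ))
    (x : Space κ n) : ‖blockMap n (frameMatrix σ a) x‖ = ‖a‖ * ‖x‖ := by
  rw [← sq_eq_sq₀ (norm_nonneg _) (by positivity), ← real_inner_self_eq_norm_sq,
    blockMap_frameMatrix, mul_pow, EuclideanSpace.norm_sq_eq]
  simp only [sum_inner, inner_sum, inner_smul_left, inner_smul_right, inner_frame hσ,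
    conj_trivial, mul_ite, mul_zero, Finset.sum_ite_eq', Finset.mem_univ, if_true, Finset.sum_mul]
  refine Finset.sum_congr rfl fun i _ => ?_
  rw [Real.norm_eq_abs, sq_abs]; ring

/-- The isometric embedding `a ↦ ∑ a_j R_{σ_j} ξ` onto the orthogonal complement of `H_ξ`. -/
def frame (hσ : IsOrthogonalSequence σ) {ξ : Space κ n} (hξ : ‖ξ‖ = 1) :
    EuclideanSpace ℝ (Fin κ) →ₗᵢ[ℝ] Space κ n where
  toFun a := blockMap n (frameMatrix σ a) ξ
  map_add' a b := by
    simp [blockMap_frameMatrix, add_smul, Finset.sum_add_distrib]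
  map_smul' c a := by
    simp [blockMap_frameMatrix, mul_smul, Finset.smul_sum]
  norm_map' a := by
    have := norm_blockMap_frameMatrix hσ a ξ
    rw [hξ, mul_one] at this
    exact this

theorem frame_apply (hσ : IsOrthogonalSequence σ) {ξ : Space κ n} (hξ : ‖ξ‖ = 1)
    (a : EuclideanSpace ℝ (Fin κ)) : frame hσ hξ a = blockMap n (frameMatrix σ a) ξ := rfl

theorem range_frame (hσ : IsOrthogonalSequence σ) {ξ : Space κ n} (hξ : ‖ξ‖ = 1) :
    (LinearMap.range (frame hσ hξ).toLinearMap)ᗮ = sectionSubspace σ ξ := by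
  unfold sectionSubspace
  congr 1
  ext x
  rw [Submodule.mem_span_range_iff_exists_fun]
  constructor
  · rintro ⟨a, rfl⟩
    refine ⟨a, ?_⟩
    simp only [← rot_apply]
    exact (blockMap_frameMatrix a ξ).symm
  · rintro ⟨c, rfl⟩
    refine ⟨WithLp.toLp 2 c, ?_⟩
    simp only [← rot_apply]
    exact blockMap_frameMatrix (WithLp.toLp 2 c) ξ

theorem finrank_sectionSubspace (hσ : IsOrthogonalSequence σ) {ξ : Space κ n} (hξ : ‖ξ‖ = 1) :
    Module.finrank ℝ (sectionSubspace σ ξ) = n * κ - κ := by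
  have h := Submodule.finrank_add_finrank_orthogonal (LinearMap.range (frame hσ hξ).toLinearMap)
  rw [range_frame, LinearMap.finrank_range_of_inj (frame hσ hξ).injective] at h
  simp only [finrank_euclideanSpace, Fintype.card_prod, Fintype.card_fin] at h
  omega

theorem frameMatrix_transpose_mul_self (hσ : IsOrthogonalSequence σ)
    {a : EuclideanSpace ℝ (Fin κ)} (ha : ‖a‖ = 1) :
    (frameMatrix σ a).transpose * frameMatrix σ a = 1 := by
  have hn : ∀ x : Fin κ → ℝ, dotProduct ((frameMatrix σ a).mulVec x) ((frameMatrix σ a).mulVec x) =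
      dotProduct x x := by
    intro x
    -- The case of a single block recovers the action on ℝ^κ; polarization then passes from norms to
    -- inner products.
    let y : Space κ 1 := WithLp.toLp 2 fun p => x p.2
    have h1 := norm_blockMap_frameMatrix hσ a y
    have h2 : inner ℝ (blockMap 1 (frameMatrix σ a) y) (blockMap 1 (frameMatrix σ a) y) =
        inner ℝ (blockMap 1 1 y) (blockMap 1 1 y) := by
      rw [blockMap_one, real_inner_self_eq_norm_sq, real_inner_self_eq_norm_sq, h1, ha, one_mul]
    rw [inner_blockMap, inner_blockMap] at h2
    simpa [y] using h2
  have hp : ∀ x y : Fin κ → ℝ, dotProduct ((frameMatrix σ a).mulVec x)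
      ((frameMatrix σ a).mulVec y) = dotProduct x y := by
    intro x y
    have h1 := hn (x + y)
    have h2 := hn x
    have h3 := hn y
    simp only [Matrix.mulVec_add, dotProduct_add, add_dotProduct] at h1
    rw [dotProduct_comm y x, dotProduct_comm ((frameMatrix σ a).mulVec y)] at h1
    linarith
  ext i j
  have := hp (Pi.single i 1) (Pi.single j 1)
  rw [Matrix.dotProduct_mulVec, Matrix.vecMul_mulVec] at this
  simpa [Matrix.one_apply, Pi.single_apply, eq_comm] using this

/-- Up to sign, the combinations of an orthogonal sequence with unit coefficients are rotations. -/
theorem exists_rotation_frameMatrix (hσ : IsOrthogonalSequence σ)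
    {a : EuclideanSpace ℝ (Fin κ)} (ha : ‖a‖ = 1) :
    ∃ τ : SO κ, frameMatrix σ a = τ.1 ∨ frameMatrix σ a = -τ.1 := by
  have hdet : ∀ b : EuclideanSpace ℝ (Fin κ), ‖b‖ = 1 →
      (frameMatrix σ b).det = 1 ∨ (frameMatrix σ b).det = -1 := by
    intro b hb
    have := congrArg Matrix.det (frameMatrix_transpose_mul_self hσ hb)
    rw [Matrix.det_mul, Matrix.det_transpose, Matrix.det_one] at this
    exact mul_self_eq_one_iff.1 this
  have of_det : ∀ A : Matrix (Fin κ) (Fin κ) ℝ, A.transpose * A = 1 → A.det = 1 →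
      ∃ τ : SO κ, A = τ.1 := fun A h1 h2 =>
    ⟨⟨A, Matrix.mem_specialOrthogonalGroup_iff.2 ⟨(Matrix.mem_orthogonalGroup_iff' _ _).2 h1, h2⟩⟩, rfl⟩
  have horth := frameMatrix_transpose_mul_self hσ ha
  rcases hdet a ha with h | h
  · obtain ⟨τ, hτ⟩ := of_det _ horth h
    exact ⟨τ, Or.inl hτ⟩
  -- In dimension one the unit sphere {±1} is disconnected, and the sign in the conclusion is really
  -- needed.
  by_cases hκ : κ = 1
  · subst hκ
    obtain ⟨τ, hτ⟩ := of_det (-frameMatrix σ a) (by simpa using horth)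
      (by rw [Matrix.det_neg, h]; simp)
    exact ⟨τ, Or.inr (by rw [← hτ, neg_neg])⟩
  · exfalso
    have hκ' : 1 < κ := by have := NeZero.ne κ; omega
    -- For κ > 1 the determinant is continuous on a connected sphere, takes only the values ±1, and
    -- equals 1 at the first basis vector because σ_0 = I.
    have conn : IsPreconnected (sphere (0 : EuclideanSpace ℝ (Fin κ)) 1) := by
      refine isPreconnected_sphere ?_ 0 1
      rw [← Module.finrank_eq_rank, finrank_euclideanSpace, Fintype.card_fin]
      exact_mod_cast hκ'
    have cont : ContinuousOn (fun b => (frameMatrix σ b).det)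
        (sphere (0 : EuclideanSpace ℝ (Fin κ)) 1) :=
      (continuous_frameMatrix.matrix_det).continuousOn
    have h0 : (frameMatrix σ (EuclideanSpace.single 0 1)).det = 1 := by
      have : frameMatrix σ (EuclideanSpace.single 0 1) = 1 := by
        simp [frameMatrix, PiLp.single_apply, hσ.zero_eq_one, ite_smul]
      rw [this, Matrix.det_one]
    have hiv := conn.intermediate_value (f := fun b => (frameMatrix σ b).det)
      (a := a) (b := EuclideanSpace.single 0 1) (by simpa using ha) (by simp) cont
    have hmem : (0 : ℝ) ∈ Icc (frameMatrix σ a).det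
        (frameMatrix σ (EuclideanSpace.single 0 1)).det := by
      rw [h, h0]; constructor <;> norm_num
    obtain ⟨b, hb, hb0⟩ := hiv hmem
    have hb0 : (frameMatrix σ b).det = 0 := hb0
    rcases hdet b (by simpa using hb) with h' | h' <;> rw [hb0] at h' <;> norm_num at h'

end Frame

/-! ### Section integrals as ray integrals of the Fourier transform. -/

section SectionFormula

theorem continuous_rayIntegral_fourier {E : Type*} [NormedAddCommGroup E] [InnerProductSpace ℝ E]
    [FiniteDimensional ℝ E] [MeasurableSpace E] [BorelSpace E] (φ : 𝓢(E, ℂ)) (k : ℕ) :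
    Continuous fun θ : sphere (0 : E) 1 => rayIntegral k (fourier φ) θ := by
  have : fourier φ = fourierSchwartz φ := funext fun ξ => (fourierSchwartz_apply φ ξ).symm
  rw [this]
  exact continuous_rayIntegral _ _

variable {κ n : ℕ} {σ : Fin κ → SO κ}

/-- The composition of a Schwartz function with `R_τ`. -/
def compRot (φ : 𝓢(Space κ n, ℂ)) (τ : SO κ) : 𝓢(Space κ n, ℂ) :=
  SchwartzMap.compCLMOfContinuousLinearEquiv ℂ (rot n τ).toContinuousLinearEquiv φ

theorem compRot_apply (φ : 𝓢(Space κ n, ℂ)) (τ : SO κ) (x : Space κ n) :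
    compRot φ τ x = φ (rot n τ x) := rfl

theorem rayIntegral_fourier_compRot (φ : 𝓢(Space κ n, ℂ)) (τ : SO κ) (k : ℕ) (x : Space κ n) :
    rayIntegral k (fourier (compRot φ τ)) x = rayIntegral k (fourier φ) (rot n τ x) := by
  simp only [rayIntegral, fourier_comp_isometry φ (compRot φ τ) (rot n τ) (compRot_apply φ τ),
    map_smul]

/-- The surface measure of the unit sphere of `ℝ^κ`. -/
def sphereMass (κ : ℕ) : ℝ :=
  (volume : Measure (EuclideanSpace ℝ (Fin κ))).toSphere.real univ

variable [NeZero κ]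

theorem sphereMass_pos : 0 < sphereMass κ := by
  have : Nonempty (Fin κ) := ⟨0⟩
  have : Nontrivial (EuclideanSpace ℝ (Fin κ)) := inferInstance
  rw [sphereMass, measureReal_def, ENNReal.toReal_pos_iff]
  refine ⟨?_, measure_lt_top _ _⟩
  rw [pos_iff_ne_zero, ne_eq, Measure.measure_univ_eq_zero]
  exact Measure.toSphere_ne_zero _

/-- This is `integral_fourier_range` for H_ξ^⊥, written in polar coordinates of the parameter space
ℝ^κ, whence the weight t^(κ-1). -/
theorem integral_rayIntegral_frame (hσ : IsOrthogonalSequence σ) {ξ : Space κ n} (hξ : ‖ξ‖ = 1)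
    (φ : 𝓢(Space κ n, ℂ)) :
    ∫ a : sphere (0 : EuclideanSpace ℝ (Fin κ)) 1,
      rayIntegral (κ - 1) (fourier φ) (blockMap n (frameMatrix σ a) ξ) ∂volume.toSphere =
    ((2 * Real.pi) ^ κ : ℝ) * ∫ h : sectionSubspace σ ξ, φ h := by
  have : Nonempty (Fin κ) := ⟨0⟩
  have hW : Module.finrank ℝ (EuclideanSpace ℝ (Fin κ)) = κ := by simp
  have h1 := integral_fourier_range φ (frame hσ hξ)
  rw [hW] at h1
  have h2 : ∀ H : Submodule ℝ (Space κ n), (LinearMap.range (frame hσ hξ).toLinearMap)ᗮ = H →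
      ∫ h : (LinearMap.range (frame hσ hξ).toLinearMap)ᗮ, φ h = ∫ h : H, φ h := by
    rintro H rfl; rfl
  rw [h2 _ (range_frame hσ hξ)] at h1
  rw [← h1]
  have hint : Integrable fun a => fourier φ (frame hσ hξ a) := by
    have := (SchwartzMap.compCLMOfAntilipschitz (K := 1) ℝ
      ((frame hσ hξ).toContinuousLinearMap.hasTemperateGrowth) (frame hσ hξ).antilipschitz
      (fourierSchwartz φ)).integrable (μ := volume)
    refine this.congr (Eventually.of_forall fun a => ?_)
    exact fourierSchwartz_apply φ _
  rw [integral_polar volume hint, hW]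
  refine integral_congr_ae (Eventually.of_forall fun a => ?_)
  simp only [rayIntegral, map_smul, Complex.real_smul]
  rfl

theorem rayIntegral_fourier_neg {E : Type*} [NormedAddCommGroup E] [InnerProductSpace ℝ E]
    [FiniteDimensional ℝ E] [MeasurableSpace E] [BorelSpace E] {φ : 𝓢(E, ℂ)}
    (h : ∀ x, φ (-x) = φ x) (k : ℕ) (ξ : E) :
    rayIntegral k (fourier φ) (-ξ) = rayIntegral k (fourier φ) ξ := by
  simp only [rayIntegral, smul_neg, fourier_neg_of_even h]

/-- For an even rotation invariant function, the integral over `H_ξ` is determined by the Fourier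
transform along the ray through `ξ`. -/
theorem rayIntegral_fourier_of_invariant (hσ : IsOrthogonalSequence σ) {ξ : Space κ n}
    (hξ : ‖ξ‖ = 1) {φ : 𝓢(Space κ n, ℂ)} (heven : ∀ x, φ (-x) = φ x)
    (hinv : ∀ (τ : SO κ) x, φ (rot n τ x) = φ x) :
    (sphereMass κ : ℂ) * rayIntegral (κ - 1) (fourier φ) ξ =
      ((2 * Real.pi) ^ κ : ℝ) * ∫ h : sectionSubspace σ ξ, φ h := by
  rw [← integral_rayIntegral_frame hσ hξ]
  -- Every unit vector of H_ξ^⊥ is ±R_τ ξ, so the invariance and evenness of `φ` make the ray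
  -- integral constant on that sphere.
  have : ∀ a : sphere (0 : EuclideanSpace ℝ (Fin κ)) 1,
      rayIntegral (κ - 1) (fourier φ) (blockMap n (frameMatrix σ a) ξ) =
      rayIntegral (κ - 1) (fourier φ) ξ := by
    intro a
    obtain ⟨τ, hτ⟩ := exists_rotation_frameMatrix hσ (a := (a : EuclideanSpace ℝ (Fin κ))) (by simp)
    have hc : compRot φ τ = φ := SchwartzMap.ext (hinv τ)
    have h1 := rayIntegral_fourier_compRot φ τ (κ - 1) ξ
    rw [hc] at h1
    rcases hτ with hτ | hτ
    · rw [hτ, ← rot_eq_blockMap]; exact h1.symm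
    · rw [hτ, blockMap_neg, rayIntegral_fourier_neg heven, ← rot_eq_blockMap]; exact h1.symm
  simp only [this, integral_const, sphereMass]
  rw [Complex.real_smul]

/-- The averaged form of `rayIntegral_fourier_of_invariant`. -/
theorem integral_rayIntegral_fourier_rot (hσ : IsOrthogonalSequence σ) {ξ : Space κ n}
    (hξ : ‖ξ‖ = 1) {φ : 𝓢(Space κ n, ℂ)} (heven : ∀ x, φ (-x) = φ x) :
    (sphereMass κ : ℂ) * ∫ τ, rayIntegral (κ - 1) (fourier φ) (rot n τ ξ) ∂(SO.haar κ) =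
      ((2 * Real.pi) ^ κ : ℝ) *
        ∫ τ, (∫ h : sectionSubspace σ ξ, φ (rot n τ h)) ∂(SO.haar κ) := by
  have h1 : ∀ τ : SO κ, ∫ a : sphere (0 : EuclideanSpace ℝ (Fin κ)) 1,
      rayIntegral (κ - 1) (fourier φ) (rot n τ (blockMap n (frameMatrix σ a) ξ)) ∂volume.toSphere =
      ((2 * Real.pi) ^ κ : ℝ) * ∫ h : sectionSubspace σ ξ, φ (rot n τ h) := by
    intro τ
    have := integral_rayIntegral_frame hσ hξ (compRot φ τ)
    simpa only [rayIntegral_fourier_compRot, compRot_apply] using this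
  -- The rotation attached to `a` is now absorbed by a right translation of the averaging variable
  -- instead of by invariance of `φ`.
  have h2 : ∀ a : sphere (0 : EuclideanSpace ℝ (Fin κ)) 1,
      ∫ τ, rayIntegral (κ - 1) (fourier φ) (rot n τ (blockMap n (frameMatrix σ a) ξ)) ∂(SO.haar κ) =
      ∫ τ, rayIntegral (κ - 1) (fourier φ) (rot n τ ξ) ∂(SO.haar κ) := by
    intro a
    obtain ⟨ρ, hρ⟩ := exists_rotation_frameMatrix hσ (a := (a : EuclideanSpace ℝ (Fin κ))) (by simp)
    have h3 : ∀ τ : SO κ, rayIntegral (κ - 1) (fourier φ)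
        (rot n τ (blockMap n (frameMatrix σ a) ξ)) =
        rayIntegral (κ - 1) (fourier φ) (rot n (τ * ρ) ξ) := by
      intro τ
      rw [rot_mul]
      rcases hρ with hρ | hρ
      · rw [hρ, ← rot_eq_blockMap]
      · rw [hρ, blockMap_neg, map_neg, rayIntegral_fourier_neg heven, ← rot_eq_blockMap]
    simp only [h3]
    exact integral_mul_right_eq_self
      (fun τ => rayIntegral (κ - 1) (fourier φ) (rot n τ ξ)) ρ
  have hcont : Continuous (Function.uncurry
      fun (τ : SO κ) (a : sphere (0 : EuclideanSpace ℝ (Fin κ)) 1) =>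
        rayIntegral (κ - 1) (fourier φ) (rot n τ (blockMap n (frameMatrix σ a) ξ))) := by
    let p : SO κ × sphere (0 : EuclideanSpace ℝ (Fin κ)) 1 → sphere (0 : Space κ n) 1 :=
      fun q => ⟨rot n q.1 (frame hσ hξ q.2), by simp⟩
    have hq : Continuous fun q : SO κ × sphere (0 : EuclideanSpace ℝ (Fin κ)) 1 =>
        frame hσ hξ q.2 :=
      (frame hσ hξ).continuous.comp (by fun_prop)
    have hp : Continuous p :=
      Continuous.subtype_mk (continuous_rot_comp continuous_fst hq) _
    have := Continuous.comp (continuous_rayIntegral_fourier φ (κ - 1)) hp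
    simpa only [Function.comp_def, p, frame_apply, Function.uncurry_def] using this
  have hswap := integral_integral_swap_of_hasCompactSupport (μ := SO.haar κ)
    (ν := (volume : Measure (EuclideanSpace ℝ (Fin κ))).toSphere) hcont
    (HasCompactSupport.of_compactSpace _)
  simp only [h1, h2, integral_const] at hswap
  rw [integral_const_mul, Complex.real_smul] at hswap
  exact hswap.symm

end SectionFormula

/-! ### Averaging over SO(κ). -/

section Average

variable {κ n : ℕ}

/-- The average of a function over the rotations `R_τ`. -/
def average (u : Space κ n → ℝ) (x : Space κ n) : ℝ := ∫ τ, u (rot n τ x) ∂(SO.haar κ)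

/-- Moving `x` by R_ρ translates the integration variable on the right, which is why `SO.haar` is
taken right invariant. -/
theorem average_rot (u : Space κ n → ℝ) (ρ : SO κ) (x : Space κ n) :
    average u (rot n ρ x) = average u x := by
  simp only [average, ← rot_mul]
  exact integral_mul_right_eq_self (fun τ => u (rot n τ x)) ρ

theorem average_neg {u : Space κ n → ℝ} (hu : ∀ x, u (-x) = u x) (x : Space κ n) :
    average u (-x) = average u x := by
  simp only [average, map_neg, hu]

theorem continuous_average {u : Space κ n → ℝ} (hu : Continuous u) : Continuous (average u) := by
  unfold average
  have h : Continuous (Function.uncurry fun (x : Space κ n) (τ : SO κ) => u (rot n τ x)) :=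
    hu.comp (continuous_rot_comp continuous_snd continuous_fst)
  have := continuous_parametric_integral_of_continuous (μ := SO.haar κ) h isCompact_univ
  simpa only [Measure.restrict_univ] using this

end Average

/-! ### Symmetric convex bodies as unit balls of norms. -/

/-- Continuous norms on a real vector space, unbundled. -/
structure IsNorm {F : Type*} [NormedAddCommGroup F] [NormedSpace ℝ F] (N : F → ℝ) : Prop where
  continuous : Continuous N
  smul : ∀ r : ℝ, 0 ≤ r → ∀ x, N (r • x) = r * N x
  neg : ∀ x, N (-x) = N x
  add_le : ∀ x y, N (x + y) ≤ N x + N y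
  pos : ∀ x, x ≠ 0 → 0 < N x

section Body

variable {F : Type*} [NormedAddCommGroup F] [NormedSpace ℝ F] {N : F → ℝ} {D : Set F}

theorem IsNorm.map_zero (hN : IsNorm N) : N 0 = 0 := by
  simpa using hN.smul 0 le_rfl 0

theorem IsNorm.nonneg (hN : IsNorm N) (x : F) : 0 ≤ N x := by
  by_cases hx : x = 0
  · rw [hx, hN.map_zero]
  · exact (hN.pos x hx).le

theorem isNorm_norm : IsNorm (fun x : F => ‖x‖) where
  continuous := continuous_norm
  smul r hr x := by rw [norm_smul, Real.norm_of_nonneg hr]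
  neg := norm_neg
  add_le := norm_add_le
  pos x hx := norm_pos_iff.2 hx

theorem IsNorm.restrict (hN : IsNorm N) (H : Submodule ℝ F) : IsNorm fun x : H => N x where
  continuous := hN.continuous.comp continuous_subtype_val
  smul r hr x := hN.smul r hr x
  neg x := hN.neg x
  add_le x y := hN.add_le x y
  pos x hx := hN.pos x (by simpa using hx)

theorem IsNorm.add {M : F → ℝ} (hN : IsNorm N) (hM : IsNorm M) : IsNorm fun x => N x + M x where
  continuous := hN.continuous.add hM.continuous
  smul r hr x := by rw [hN.smul r hr, hM.smul r hr, mul_add]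
  neg x := by rw [hN.neg, hM.neg]
  add_le x y := by linarith [hN.add_le x y, hM.add_le x y]
  pos x hx := add_pos (hN.pos x hx) (hM.pos x hx)

theorem IsNorm.const_mul {c : ℝ} (hc : 0 < c) (hN : IsNorm N) : IsNorm fun x => c * N x where
  continuous := hN.continuous.const_mul c
  smul r hr x := by rw [hN.smul r hr]; ring
  neg x := by rw [hN.neg]
  add_le x y := by rw [← mul_add]; exact mul_le_mul_of_nonneg_left (hN.add_le x y) hc.le
  pos x hx := mul_pos hc (hN.pos x hx)

theorem IsNorm.eq_norm_mul (hN : IsNorm N) {x : F} (hx : x ≠ 0) :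
    N x = ‖x‖ * N (‖x‖⁻¹ • x) := by
  rw [← hN.smul _ (norm_nonneg _), smul_smul, mul_inv_cancel₀ (norm_ne_zero_iff.2 hx), one_smul]

theorem IsNorm.exists_le [ProperSpace F] (hN : IsNorm N) : ∃ c, 0 < c ∧ ∀ x, c * ‖x‖ ≤ N x := by
  -- The sphere is empty exactly when the space is trivial; otherwise the constant is the minimum of
  -- `N` on it.
  rcases (sphere (0 : F) 1).eq_empty_or_nonempty with h | h
  · refine ⟨1, one_pos, fun x => ?_⟩
    by_cases hx : x = 0
    · simp [hx, hN.map_zero]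
    · have : ‖x‖⁻¹ • x ∈ sphere (0 : F) 1 := by
        simp [norm_smul, hx]
      simp [h] at this
  · obtain ⟨x₀, hx₀, hmin⟩ := (isCompact_sphere (0 : F) 1).exists_isMinOn h hN.continuous.continuousOn
    refine ⟨N x₀, hN.pos _ (ne_zero_of_mem_unit_sphere ⟨x₀, hx₀⟩), fun x => ?_⟩
    by_cases hx : x = 0
    · simp [hx, hN.map_zero]
    · rw [hN.eq_norm_mul hx, mul_comm]
      refine mul_le_mul_of_nonneg_left (hmin ?_) (norm_nonneg _)
      simp [norm_smul, hx]

theorem IsNorm.isSymmetricConvexBody [ProperSpace F] (hN : IsNorm N) :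
    IsSymmetricConvexBody {x | N x ≤ 1} where
  isCompact := by
    obtain ⟨c, hc, h⟩ := hN.exists_le
    refine IsCompact.of_isClosed_subset (isCompact_closedBall (0 : F) c⁻¹)
      (isClosed_le hN.continuous continuous_const) fun x hx => ?_
    have hx : N x ≤ 1 := hx
    rw [mem_closedBall_zero_iff, ← one_div, le_div_iff₀ hc, mul_comm]
    exact (h x).trans hx
  convex := by
    intro x hx y hy a b ha hb hab
    have hx : N x ≤ 1 := hx
    have hy : N y ≤ 1 := hy
    have := hN.add_le (a • x) (b • y)
    rw [hN.smul a ha, hN.smul b hb] at this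
    show N _ ≤ 1
    nlinarith
  nonempty_interior := by
    refine ⟨0, mem_interior_iff_mem_nhds.2 ?_⟩
    have : ∀ᶠ x in 𝓝 (0 : F), N x < 1 :=
      hN.continuous.continuousAt.eventually_lt_const (by rw [hN.map_zero]; exact one_pos)
    filter_upwards [this] with x hx using hx.le
  neg_mem x hx := by
    have hx : N x ≤ 1 := hx
    exact (hN.neg x).trans_le hx

theorem IsNorm.gauge_eq (hN : IsNorm N) : gauge {x | N x ≤ 1} = N := by
  ext x
  rw [gauge_def']
  have : {r : ℝ | r ∈ Ioi (0 : ℝ) ∧ r⁻¹ • x ∈ {x | N x ≤ 1}} = {r | 0 < r ∧ N x ≤ r} := by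
    ext r
    simp only [mem_Ioi, mem_ofPred_eq]
    refine and_congr_right fun hr => ?_
    rw [hN.smul _ (inv_nonneg.2 hr.le), inv_mul_le_iff₀ hr, mul_one]
  refine (congrArg sInf this).trans ?_
  apply le_antisymm
  · refine le_of_forall_pos_le_add fun ε hε => ?_
    refine csInf_le ⟨0, fun r hr => hr.1.le⟩ ⟨?_, ?_⟩ <;> linarith [hN.nonneg x]
  · refine le_csInf ⟨N x + 1, ?_, ?_⟩ fun r hr => hr.2 <;> linarith [hN.nonneg x]

/-- The origin is the midpoint of an interior point and its reflection. -/
theorem IsSymmetricConvexBody.mem_nhds (hD : IsSymmetricConvexBody D) : D ∈ 𝓝 (0 : F) := by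
  obtain ⟨x, hx⟩ := hD.nonempty_interior
  have h := hD.convex.combo_interior_self_mem_interior hx (hD.neg_mem x (interior_subset hx))
    (a := 1 / 2) (b := 1 / 2) (by norm_num) (by norm_num) (by norm_num)
  rw [smul_neg, add_neg_cancel] at h
  exact mem_interior_iff_mem_nhds.1 h

theorem IsSymmetricConvexBody.isNorm_gauge (hD : IsSymmetricConvexBody D) : IsNorm (gauge D) where
  continuous := continuous_gauge hD.convex hD.mem_nhds
  smul r hr x := by rw [gauge_smul_of_nonneg hr, smul_eq_mul]
  neg := gauge_neg hD.neg_mem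
  add_le := gauge_add_le hD.convex (absorbent_nhds_zero hD.mem_nhds)
  pos x hx := (gauge_pos (absorbent_nhds_zero hD.mem_nhds)
    ((NormedSpace.isVonNBounded_iff ℝ).2 hD.isCompact.isBounded)).2 hx

theorem IsSymmetricConvexBody.gauge_le_one_iff (hD : IsSymmetricConvexBody D) {x : F} :
    gauge D x ≤ 1 ↔ x ∈ D := by
  rw [gauge_le_one_iff_mem_closure hD.convex hD.mem_nhds, hD.isCompact.isClosed.closure_eq]

theorem IsSymmetricConvexBody.eq_unit (hD : IsSymmetricConvexBody D) :
    D = {x | gauge D x ≤ 1} := by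
  ext x; exact hD.gauge_le_one_iff.symm

end Body

/-! ### Volumes and negative powers of norms in polar coordinates. -/

section Integrals

variable {F : Type*} [NormedAddCommGroup F] [NormedSpace ℝ F] [MeasurableSpace F]
  [FiniteDimensional ℝ F] [BorelSpace F] [Nontrivial F] (μ : Measure F) [μ.IsAddHaarMeasure]
  {N : F → ℝ}

/-- The volume of the unit ball of a norm in polar coordinates. -/
theorem IsNorm.measureReal_le_one (hN : IsNorm N) :
    Module.finrank ℝ F * μ.real {x | N x ≤ 1} =
      ∫ θ : sphere (0 : F) 1, (N θ ^ Module.finrank ℝ F)⁻¹ ∂μ.toSphere := by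
  have : ProperSpace F := FiniteDimensional.proper ℝ F
  have hm : 0 < Module.finrank ℝ F := Module.finrank_pos
  have hmeas : MeasurableSet {x | N x ≤ 1} :=
    (isClosed_le hN.continuous continuous_const).measurableSet
  have h1 : μ.real {x | N x ≤ 1} = ∫ x, indicator {x | N x ≤ 1} (1 : F → ℝ) x ∂μ := by
    rw [integral_indicator_one hmeas]
  have hint : Integrable (indicator {x | N x ≤ 1} (1 : F → ℝ)) μ := by
    rw [integrable_indicator_iff hmeas]
    exact integrableOn_const hN.isSymmetricConvexBody.isCompact.measure_lt_top.ne
  rw [h1, integral_polar μ hint, ← integral_const_mul]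
  refine integral_congr_ae (Eventually.of_forall fun θ => ?_)
  simp only
  have hθ : 0 < N θ := hN.pos θ (ne_zero_of_mem_unit_sphere θ)
  have h2 : ∫ r in Ioi (0 : ℝ), r ^ (Module.finrank ℝ F - 1) •
      indicator {x | N x ≤ 1} (1 : F → ℝ) (r • (θ : F)) =
      ∫ r in Ioi (0 : ℝ), indicator (Iic (N θ)⁻¹) (fun r => r ^ (Module.finrank ℝ F - 1)) r := by
    refine setIntegral_congr_fun measurableSet_Ioi fun r hr => ?_
    have hr : 0 < r := hr
    have : (r • (θ : F) ∈ {x | N x ≤ 1}) ↔ r ∈ Iic (N θ)⁻¹ := by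
      simp only [mem_ofPred_eq, mem_Iic, hN.smul r hr.le]
      rw [← one_div, le_div_iff₀ hθ]
    by_cases h : r ∈ Iic (N θ)⁻¹
    · simp only [indicator_of_mem h, indicator_of_mem (this.2 h), Pi.one_apply, smul_eq_mul, mul_one]
    · simp only [indicator_of_notMem h, indicator_of_notMem (mt this.1 h), smul_zero]
  rw [h2, setIntegral_indicator measurableSet_Iic, Ioi_inter_Iic,
    ← intervalIntegral.integral_of_le (by positivity), integral_pow, Nat.sub_add_cancel hm]
  have : ((Module.finrank ℝ F - 1 : ℕ) : ℝ) + 1 = Module.finrank ℝ F := by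
    exact_mod_cast Nat.sub_add_cancel hm
  rw [this, zero_pow hm.ne', sub_zero, inv_pow]
  have : (Module.finrank ℝ F : ℝ) ≠ 0 := by exact_mod_cast hm.ne'
  field_simp

variable {X : Type*} [NormedAddCommGroup X] [NormedSpace ℝ X]

/-- Negative powers of a norm of order less than the dimension are integrable against rapidly
decaying functions. -/
theorem IsNorm.integrable_inv_pow_smul (hN : IsNorm N) {k : ℕ} (hk : k < Module.finrank ℝ F)
    {g : F → X} (hg : AEStronglyMeasurable g μ) {C : ℝ}
    (hC : ∀ x, (1 + ‖x‖) ^ (Module.finrank ℝ F + 1) * ‖g x‖ ≤ C) :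
    Integrable (fun x => (N x ^ k)⁻¹ • g x) μ := by
  have : ProperSpace F := FiniteDimensional.proper ℝ F
  set d := Module.finrank ℝ F
  obtain ⟨c, hc, hcN⟩ := hN.exists_le
  -- A radial majorant. Against the polar weight y^(d-1) the pole leaves y^(d-1-k), a nonnegative
  -- power since k < d, and the decay leaves a factor (1 + y)^(-2).
  let f : ℝ → ℝ := fun y => ((c * y) ^ k)⁻¹ * (C * ((1 + y) ^ (d + 1))⁻¹)
  have hf : Integrable (fun x : F => f ‖x‖) μ := by
    rw [integrable_fun_norm_addHaar]
    have hb := integrableOn_inv_one_add_sq (|C| * (c ^ k)⁻¹)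
    refine hb.mono' ?_ ?_
    · refine Measurable.aestronglyMeasurable ?_
      simp only [f]
      fun_prop
    · filter_upwards [ae_restrict_mem measurableSet_Ioi] with y hy
      have hy : 0 < y := hy
      simp only [f, smul_eq_mul, norm_mul, norm_inv, norm_pow, Real.norm_eq_abs]
      rw [abs_of_pos hc, abs_of_pos hy, abs_of_pos (show 0 < 1 + y by linarith)]
      have e : y ^ (d - 1) = y ^ k * y ^ (d - 1 - k) := by
        rw [← pow_add]; congr 1; omega
      have e2 : (1 + y) ^ (d + 1) = (1 + y) ^ (d - 1) * (1 + y) ^ 2 := by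
        rw [← pow_add]; congr 1; omega
      have e3 : y ^ (d - 1 - k) ≤ (1 + y) ^ (d - 1) := by
        calc y ^ (d - 1 - k) ≤ (1 + y) ^ (d - 1 - k) := by gcongr; linarith
          _ ≤ (1 + y) ^ (d - 1) := pow_le_pow_right₀ (by linarith) (by omega)
      rw [e, e2, mul_pow]
      have e4 : y ^ k * y ^ (d - 1 - k) * ((c ^ k * y ^ k)⁻¹ *
          (|C| * ((1 + y) ^ (d - 1) * (1 + y) ^ 2)⁻¹)) =
          (|C| * (c ^ k)⁻¹ * ((1 + y) ^ 2)⁻¹) * (y ^ (d - 1 - k) / (1 + y) ^ (d - 1)) := by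
        field_simp
      rw [e4]
      refine mul_le_of_le_one_right (by positivity) ?_
      exact (div_le_one (by positivity)).2 e3
  refine hf.mono' ?_ ?_
  · refine AEStronglyMeasurable.smul ?_ hg
    exact ((hN.continuous.measurable.pow_const k).inv).aestronglyMeasurable
  · have h0 : ∀ᵐ x ∂μ, x ≠ 0 := by
      simp [ae_iff]
    filter_upwards [h0] with x hx
    have hx' : 0 < ‖x‖ := norm_pos_iff.2 hx
    rw [norm_smul, norm_inv, norm_pow, Real.norm_of_nonneg (hN.nonneg x)]
    simp only [f]
    gcongr
    · exact hcN x
    · rw [← div_eq_mul_inv, le_div_iff₀ (by positivity), mul_comm]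
      exact hC x

theorem IsNorm.integrable_inv_pow_mul_schwartz (hN : IsNorm N) {k : ℕ}
    (hk : k < Module.finrank ℝ F) (φ : 𝓢(F, ℂ)) :
    Integrable (fun x => (((N x ^ k)⁻¹ : ℝ) : ℂ) * φ x) μ := by
  obtain ⟨C, hC⟩ := exists_norm_schwartz_le φ (Module.finrank ℝ F + 1)
  refine (hN.integrable_inv_pow_smul μ hk φ.continuous.aestronglyMeasurable hC).congr
    (Eventually.of_forall fun x => ?_)
  simp only [Complex.real_smul]

/-- Homogeneity takes r^(-k) out of the polar weight r^(d-1). For d = κn and k = κ the remaining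
exponent κn-κ-1 is the polar weight of the sections H_ξ, so one ray integral serves both the whole
space and the sections. -/
theorem IsNorm.integral_inv_pow_mul_schwartz (hN : IsNorm N) {k : ℕ}
    (hk : k < Module.finrank ℝ F) (φ : 𝓢(F, ℂ)) :
    ∫ x, (((N x ^ k)⁻¹ : ℝ) : ℂ) * φ x ∂μ = ∫ θ : sphere (0 : F) 1,
      (((N θ ^ k)⁻¹ : ℝ) : ℂ) * rayIntegral (Module.finrank ℝ F - k - 1) φ θ ∂μ.toSphere := by
  rw [integral_polar μ (hN.integrable_inv_pow_mul_schwartz μ hk φ)]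
  refine integral_congr_ae (Eventually.of_forall fun θ => ?_)
  simp only [rayIntegral]
  rw [← integral_const_mul]
  refine setIntegral_congr_fun measurableSet_Ioi fun r hr => ?_
  have hr : 0 < r := hr
  have hθ : 0 < N θ := hN.pos θ (ne_zero_of_mem_unit_sphere θ)
  have e : r ^ (Module.finrank ℝ F - 1) * ((r * N θ) ^ k)⁻¹ =
      (N θ ^ k)⁻¹ * r ^ (Module.finrank ℝ F - k - 1) := by
    have : r ^ (Module.finrank ℝ F - 1) = r ^ k * r ^ (Module.finrank ℝ F - k - 1) := by
      rw [← pow_add]; congr 1; omega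
    rw [this, mul_pow]
    field_simp
  simp only [hN.smul r hr.le, Complex.real_smul]
  rw [← mul_assoc, ← Complex.ofReal_mul, e, Complex.ofReal_mul, mul_assoc]

end Integrals

/-! ### Smooth approximation of indicators of convex bodies. -/

section Mollifier

variable {E : Type*} [NormedAddCommGroup E]

/-- A smooth radial function, positive exactly on the ball of radius `δ`. -/
def radialBump (δ : ℝ) (x : E) : ℝ := Real.smoothTransition (δ ^ 2 - ‖x‖ ^ 2)

theorem radialBump_nonneg (δ : ℝ) (x : E) : 0 ≤ radialBump δ x := Real.smoothTransition.nonneg _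

theorem radialBump_pos {δ : ℝ} {x : E} (hx : ‖x‖ < δ) : 0 < radialBump δ x :=
  Real.smoothTransition.pos_of_pos (by nlinarith [norm_nonneg x])

theorem radialBump_eq_zero {δ : ℝ} (hδ : 0 ≤ δ) {x : E} (hx : δ ≤ ‖x‖) : radialBump δ x = 0 :=
  Real.smoothTransition.zero_of_nonpos (by nlinarith)

theorem radialBump_map {F : Type*} [FunLike F E E] {R : F} (hR : ∀ x, ‖R x‖ = ‖x‖) (δ : ℝ) (x : E) :
    radialBump δ (R x) = radialBump δ x := by
  simp only [radialBump, hR]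

variable [InnerProductSpace ℝ E]

theorem contDiff_radialBump (δ : ℝ) : ContDiff ℝ (⊤ : ℕ∞) (radialBump δ : E → ℝ) :=
  Real.smoothTransition.contDiff.comp (contDiff_const.sub (contDiff_norm_sq ℝ))

variable [FiniteDimensional ℝ E]

theorem hasCompactSupport_radialBump {δ : ℝ} (hδ : 0 ≤ δ) :
    HasCompactSupport (radialBump δ : E → ℝ) := by
  refine HasCompactSupport.intro (isCompact_closedBall (0 : E) δ) fun x hx => ?_
  refine radialBump_eq_zero hδ ?_
  rw [mem_closedBall_zero_iff, not_le] at hx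
  exact hx.le

variable [MeasurableSpace E] [BorelSpace E]

theorem integral_radialBump_pos {δ : ℝ} (hδ : 0 < δ) : 0 < ∫ x : E, radialBump δ x := by
  have hc : Continuous (radialBump δ : E → ℝ) := (contDiff_radialBump δ).continuous
  refine hc.integral_pos_of_hasCompactSupport_nonneg_nonzero (hasCompactSupport_radialBump hδ.le)
    (radialBump_nonneg δ) (x := 0) (radialBump_pos (by simpa using hδ)).ne'

/-- A smooth function between the indicators of two dilates of the unit ball of a norm, with all
symmetries of the norm. -/
theorem IsNorm.exists_schwartz_between {N : E → ℝ} (hN : IsNorm N) {s t : ℝ} (hst : s < t) :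
    ∃ (p : E → ℝ) (φ : 𝓢(E, ℂ)), (∀ x, φ x = p x) ∧ (∀ x, 0 ≤ p x) ∧ (∀ x, p x ≤ 1) ∧
      (∀ x, N x ≤ s → p x = 1) ∧ (∀ x, t < N x → p x = 0) ∧
      ∀ R : E ≃ₗᵢ[ℝ] E, (∀ x, N (R x) = N x) → ∀ x, p (R x) = p x := by
  -- The indicator of {N ≤ (s+t)/2} is convolved with a bump supported where N < (t-s)/2, so values
  -- change only for `N` between `s` and `t`. The bump is radial, hence every isometry preserving
  -- `N` preserves the result.
  set u := (s + t) / 2 with hu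
  set A := {x | N x ≤ u} with hA
  have hAclosed : IsClosed A := isClosed_le hN.continuous continuous_const
  obtain ⟨c, hc, hcN⟩ := hN.exists_le
  have hAcomp : IsCompact A := by
    refine IsCompact.of_isClosed_subset (isCompact_closedBall (0 : E) (u / c)) hAclosed fun x hx => ?_
    rw [mem_closedBall_zero_iff, le_div_iff₀ hc, mul_comm]
    exact (hcN x).trans hx
  obtain ⟨δ, hδ, hδN⟩ : ∃ δ > 0, ∀ y, ‖y‖ < δ → N y < (t - s) / 2 := by
    have := hN.continuous.continuousAt (x := 0)
    rw [Metric.continuousAt_iff] at this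
    obtain ⟨δ, hδ, h⟩ := this ((t - s) / 2) (by linarith)
    refine ⟨δ, hδ, fun y hy => ?_⟩
    have := h (x := y) (by simpa using hy)
    rw [hN.map_zero, Real.dist_eq, sub_zero] at this
    exact (le_abs_self _).trans_lt this
  set I := ∫ x : E, radialBump δ x with hI
  have hIpos : 0 < I := integral_radialBump_pos hδ
  set ρ : E → ℝ := fun x => radialBump δ x / I with hρ
  have hρ0 : ∀ x, 0 ≤ ρ x := fun x => div_nonneg (radialBump_nonneg δ x) hIpos.le
  have hρc : ContDiff ℝ (⊤ : ℕ∞) ρ := (contDiff_radialBump δ).div_const I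
  have hρs : HasCompactSupport ρ := by
    have := (hasCompactSupport_radialBump (E := E) hδ.le).mul_right (f' := fun _ => I⁻¹)
    exact this
  have hρi : Integrable ρ := hρc.continuous.integrable_of_hasCompactSupport hρs
  have hρone : ∫ x, ρ x = 1 := by
    rw [integral_div, ← hI, div_self hIpos.ne']
  have hρN : ∀ y, ρ y ≠ 0 → N y < (t - s) / 2 := by
    intro y hy
    refine hδN y ?_
    by_contra h
    exact hy (by simp [hρ, radialBump_eq_zero hδ.le (not_lt.1 h)])
  have hρR : ∀ (R : E ≃ₗᵢ[ℝ] E) x, ρ (R x) = ρ x := by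
    intro R x; simp only [hρ, radialBump_map R.norm_map]
  let f : E → ℝ := indicator A 1
  have hf : Integrable f := by
    rw [integrable_indicator_iff hAclosed.measurableSet]
    exact integrableOn_const hAcomp.measure_lt_top.ne
  let p : E → ℝ := MeasureTheory.convolution f ρ (ContinuousLinearMap.lsmul ℝ ℝ) volume
  have hp : ∀ x, p x = ∫ y, f y * ρ (x - y) := fun x => rfl
  have hpc : ContDiff ℝ (⊤ : ℕ∞) p := hρs.contDiff_convolution_right _ hf.locallyIntegrable hρc
  have hfs : HasCompactSupport f :=
    HasCompactSupport.intro hAcomp fun x hx => indicator_of_notMem hx _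
  have hps : HasCompactSupport p := HasCompactSupport.convolution _ hfs hρs
  have hρx : ∀ x, Integrable fun y => ρ (x - y) := fun x => hρi.comp_sub_left x
  have hρx1 : ∀ x, ∫ y, ρ (x - y) = 1 := fun x => by
    rw [integral_sub_left_eq_self (fun y => ρ y) volume x, hρone]
  have hf0 : ∀ x, 0 ≤ f x := fun x => indicator_nonneg (fun _ _ => zero_le_one) x
  have hf1 : ∀ x, f x ≤ 1 := fun x => indicator_le_self' (fun _ _ => zero_le_one) x
  have hN_sub : ∀ x y, N x ≤ N y + N (x - y) := fun x y => by
    simpa using hN.add_le y (x - y)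
  have hN_sub' : ∀ x y, N y ≤ N x + N (x - y) := fun x y => by
    have := hN.add_le x (-(x - y))
    rw [hN.neg] at this
    simpa using this
  let q : E → ℂ := fun x => (p x : ℂ)
  have hqc : ContDiff ℝ (⊤ : ℕ∞) q := Complex.ofRealCLM.contDiff.comp hpc
  have hqs : HasCompactSupport q := hps.comp_left (g := fun r : ℝ => (r : ℂ)) rfl
  refine ⟨p, hqs.toSchwartzMap hqc, fun x => rfl, fun x => ?_, fun x => ?_, fun x hx => ?_,
    fun x hx => ?_, fun R hR x => ?_⟩
  · rw [hp]
    exact integral_nonneg fun y => mul_nonneg (hf0 y) (hρ0 _)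
  · rw [hp, ← hρx1 x]
    refine integral_mono_of_nonneg (Eventually.of_forall fun y => mul_nonneg (hf0 y) (hρ0 _))
      (hρx x) (Eventually.of_forall fun y => ?_)
    exact mul_le_of_le_one_left (hρ0 _) (hf1 y)
  · rw [hp, ← hρx1 x]
    refine integral_congr_ae (Eventually.of_forall fun y => ?_)
    by_cases h : ρ (x - y) = 0
    · simp [h]
    · have hy : y ∈ A := by
        have h1 := hρN _ h
        have h2 := hN_sub' x y
        show N y ≤ u
        rw [hu]; linarith
      simp [f, indicator_of_mem hy]
  · rw [hp]
    refine integral_eq_zero_of_ae (Eventually.of_forall fun y => ?_)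
    by_cases h : ρ (x - y) = 0
    · simp [h]
    · have hy : y ∉ A := by
        have h1 := hρN _ h
        have h2 := hN_sub x y
        intro (h3 : N y ≤ u)
        rw [hu] at h3; linarith
      simp [f, indicator_of_notMem hy]
  · rw [hp, hp, ← R.measurePreserving.integral_comp R.toHomeomorph.measurableEmbedding]
    refine integral_congr_ae (Eventually.of_forall fun y => ?_)
    have h1 : f (R y) = f y := by
      simp only [f, indicator, hA, mem_ofPred_eq, hR]
      rfl
    simp only [h1, ← map_sub, hρR]

end Mollifier

/-! ### Intersection bodies imply the affirmative answer. -/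

section Sufficiency

variable {κ n : ℕ} {σ : Fin κ → SO κ}

theorem finrank_space : Module.finrank ℝ (Space κ n) = n * κ := by simp

theorem IsNorm.measureReal_le {N : Space κ n → ℝ} (hN : IsNorm N) {r : ℝ} (hr : 0 < r) :
    volume.real {x | N x ≤ r} = r ^ (n * κ) * volume.real {x | N x ≤ 1} := by
  have : {x | N x ≤ r} = r • {x | N x ≤ 1} := by
    ext x
    rw [mem_smul_set_iff_inv_smul_mem₀ hr.ne', mem_ofPred_eq, mem_ofPred_eq,
      hN.smul _ (inv_nonneg.2 hr.le), inv_mul_le_iff₀ hr, mul_one]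
  rw [this, measureReal_def, Measure.addHaar_smul, finrank_space, ENNReal.toReal_mul,
    ENNReal.toReal_ofReal (abs_nonneg _), abs_of_pos (by positivity), measureReal_def]

variable [NeZero κ]

theorem nontrivial_space (hn : 2 ≤ n) : Nontrivial (Space κ n) := by
  have : 0 < κ := NeZero.pos κ
  have : Nonempty (Fin n × Fin κ) := ⟨⟨0, by omega⟩, 0⟩
  infer_instance

theorem lt_finrank_space (hn : 2 ≤ n) : κ < Module.finrank ℝ (Space κ n) := by
  have : 0 < κ := NeZero.pos κ
  rw [finrank_space]
  nlinarith

/-- If `D` is a `κ`-intersection body, integrals of rotation invariant functions against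
`‖x‖_D^{-κ}` are averages of their integrals over the sections `H_ξ`. -/
theorem IsIntersectionBody.exists_section_identity (hσ : IsOrthogonalSequence σ)
    {D : Set (Space κ n)} (h : IsIntersectionBody κ D) :
    ∃ μ : Measure (sphere (0 : Space κ n) 1), IsFiniteMeasure μ ∧
      ∀ (p : Space κ n → ℝ) (φ : 𝓢(Space κ n, ℂ)), (∀ x, φ x = p x) → (∀ x, p (-x) = p x) →
        (∀ (τ : SO κ) x, p (rot n τ x) = p x) →
        Integrable (fun ξ : sphere (0 : Space κ n) 1 => ∫ y : sectionSubspace σ (ξ : Space κ n), p y) μ ∧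
        ∫ x, (gauge D x ^ κ)⁻¹ * p x = (2 * Real.pi) ^ κ / sphereMass κ *
          ∫ ξ : sphere (0 : Space κ n) 1, (∫ y : sectionSubspace σ (ξ : Space κ n), p y) ∂μ := by
  obtain ⟨μ, hμ, h⟩ := h
  refine ⟨μ, hμ, fun p φ hφ heven hinv => ?_⟩
  set c := (2 * Real.pi) ^ κ / sphereMass κ with hc
  have hm : 0 < sphereMass κ := sphereMass_pos
  have hcpos : 0 < c := by have := Real.pi_pos; positivity
  have hT : ∀ ξ : sphere (0 : Space κ n) 1, rayIntegral (κ - 1) (fourier φ) ξ =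
      ((c * ∫ y : sectionSubspace σ (ξ : Space κ n), p y : ℝ) : ℂ) := by
    intro ξ
    have h1 := rayIntegral_fourier_of_invariant hσ (ξ := (ξ : Space κ n)) (by simp) (φ := φ)
      (fun x => by rw [hφ, hφ, heven]) (fun τ x => by rw [hφ, hφ, hinv])
    simp only [hφ] at h1
    rw [integral_complex_ofReal] at h1
    have hm' : (sphereMass κ : ℂ) ≠ 0 := by exact_mod_cast hm.ne'
    rw [hc]
    push_cast at h1 ⊢
    field_simp
    rw [mul_comm, h1]
  -- The domain of integration varies with ξ; the regularity of the section integrals is read off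
  -- from the continuity of the ray integrals.
  have hint : Integrable (fun ξ : sphere (0 : Space κ n) 1 =>
      c * ∫ y : sectionSubspace σ (ξ : Space κ n), p y) μ := by
    have h1 : Continuous fun ξ : sphere (0 : Space κ n) 1 =>
        (rayIntegral (κ - 1) (fourier φ) ξ).re :=
      Complex.continuous_re.comp (continuous_rayIntegral_fourier φ (κ - 1))
    have h2 := h1.integrable_of_hasCompactSupport (μ := μ) (HasCompactSupport.of_compactSpace _)
    refine h2.congr (Eventually.of_forall fun ξ => ?_)
    simp only [hT, Complex.ofReal_re]
  constructor
  · have := hint.const_mul c⁻¹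
    refine this.congr (Eventually.of_forall fun ξ => ?_)
    field_simp
  · have h1 := h φ (fun x => by rw [hφ, hφ, heven])
    have h2 : ∀ ξ : sphere (0 : Space κ n) 1,
        ∫ t in Ioi (0 : ℝ), ((t ^ (κ - 1) : ℝ) : ℂ) * fourier φ (t • (ξ : Space κ n)) =
        ((c * ∫ y : sectionSubspace σ (ξ : Space κ n), p y : ℝ) : ℂ) := hT
    simp only [h2, hφ, ← Complex.ofReal_mul] at h1
    rw [integral_complex_ofReal, integral_complex_ofReal, Complex.ofReal_inj,
      integral_const_mul] at h1
    exact h1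

/-- By contradiction: a strict volume inequality leaves room to shrink `K` to sK and enlarge `L` to
tL, and smooth test functions fit between 1_{sK} and 1_K and between 1_L and 1_{tL}. Only `K` has to
be an intersection body. -/
theorem affirmativeAnswer_of_isIntersectionBody (hn : 2 ≤ n) (hσ : IsOrthogonalSequence σ)
    (h : ∀ D : Set (Space κ n), IsSymmetricConvexBody D → IsRotationInvariant D →
      IsIntersectionBody κ D) : AffirmativeAnswer n σ := by
  intro K L hK hKinv hL hLinv hsec
  have := nontrivial_space (κ := κ) hn
  by_contra hlt
  rw [not_le] at hlt
  set M := gauge K with hM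
  set N := gauge L with hNdef
  have hMn : IsNorm M := hK.isNorm_gauge
  have hNn : IsNorm N := hL.isNorm_gauge
  have hMrot : ∀ (τ : SO κ) x, M (rot n τ x) = M x := fun τ x => by rw [rot_apply]; exact hKinv τ x
  have hNrot : ∀ (τ : SO κ) x, N (rot n τ x) = N x := fun τ x => by rw [rot_apply]; exact hLinv τ x
  have hKM : K = {x | M x ≤ 1} := hK.eq_unit
  have hLN : L = {x | N x ≤ 1} := hL.eq_unit
  obtain ⟨s, t, hs0, hs1, ht1, hst⟩ : ∃ s t : ℝ, 0 < s ∧ s < 1 ∧ 1 < t ∧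
      volume.real {x | N x ≤ t} < volume.real {x | M x ≤ s} := by
    have h0 : volume.real {x | N x ≤ 1} < volume.real {x | M x ≤ 1} := by
      rw [← hKM, ← hLN]
      exact (ENNReal.toReal_lt_toReal hL.isCompact.measure_lt_top.ne
        hK.isCompact.measure_lt_top.ne).2 hlt
    -- With s = r and t = 2 - r, a single continuity argument at r = 1 provides both dilation
    -- factors.
    have hcont : ContinuousAt (fun r : ℝ => r ^ (n * κ) * volume.real {x | M x ≤ 1} -
        (2 - r) ^ (n * κ) * volume.real {x | N x ≤ 1}) 1 := by fun_prop
    have hev := hcont.eventually_const_lt (u := 0) (by norm_num; exact h0)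
    have hev2 : ∀ᶠ r in 𝓝[<] (1 : ℝ), r < 1 := eventually_mem_nhdsWithin
    have hev3 : ∀ᶠ r in 𝓝[<] (1 : ℝ), 0 < r :=
      (eventually_gt_nhds one_pos).filter_mono nhdsWithin_le_nhds
    obtain ⟨r, hr1, hr2, hr3⟩ := ((hev.filter_mono nhdsWithin_le_nhds).and (hev2.and hev3)).exists
    refine ⟨r, 2 - r, hr3, hr2, by linarith, ?_⟩
    rw [hMn.measureReal_le hr3, hNn.measureReal_le (by linarith)]
    linarith
  obtain ⟨p, φ, hφ, hp0, hp1, hps, hpt, hpR⟩ := hMn.exists_schwartz_between hs1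
  obtain ⟨q, ψ, hψ, hq0, hq1, hqs, hqt, hqR⟩ := hNn.exists_schwartz_between ht1
  obtain ⟨μ, hμ, hid⟩ := (h K hK hKinv).exists_section_identity hσ
  obtain ⟨hpi, hpe⟩ := hid p φ hφ
    (hpR (LinearIsometryEquiv.neg ℝ) hMn.neg) (fun τ => hpR (rot n τ) (hMrot τ))
  obtain ⟨hqi, hqe⟩ := hid q ψ hψ
    (hqR (LinearIsometryEquiv.neg ℝ) hNn.neg) (fun τ => hqR (rot n τ) (hNrot τ))
  have hcpos : 0 < (2 * Real.pi) ^ κ / sphereMass κ := by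
    have := Real.pi_pos
    have := sphereMass_pos (κ := κ)
    positivity
  have hpc : Continuous p := by
    have : p = fun x => (φ x).re := funext fun x => by rw [hφ, Complex.ofReal_re]
    rw [this]; exact Complex.continuous_re.comp φ.continuous
  have hqc : Continuous q := by
    have : q = fun x => (ψ x).re := funext fun x => by rw [hψ, Complex.ofReal_re]
    rw [this]; exact Complex.continuous_re.comp ψ.continuous
  have hIq : ∫ x, (M x ^ κ)⁻¹ * p x ≤ ∫ x, (M x ^ κ)⁻¹ * q x := by
    rw [hpe, hqe]
    refine mul_le_mul_of_nonneg_left (integral_mono hpi hqi fun ξ => ?_) hcpos.le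
    set H := sectionSubspace σ (ξ : Space κ n) with hH
    have hMH := hMn.restrict H
    have hNH := hNn.restrict H
    have hKc : IsCompact {y : H | M y ≤ 1} := hMH.isSymmetricConvexBody.isCompact
    have hLc : IsCompact {y : H | N y ≤ 1} := hNH.isSymmetricConvexBody.isCompact
    have hvol : volume.real {y : H | M y ≤ 1} ≤ volume.real {y : H | N y ≤ 1} := by
      have h1 := hsec ξ (by simp)
      rw [← hH, sectionVolume, sectionVolume] at h1
      have e1 : {y : H | (y : Space κ n) ∈ K} = {y : H | M y ≤ 1} := by
        ext y; exact hK.gauge_le_one_iff.symm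
      have e2 : {y : H | (y : Space κ n) ∈ L} = {y : H | N y ≤ 1} := by
        ext y; exact hL.gauge_le_one_iff.symm
      rw [e1, e2] at h1
      exact ENNReal.toReal_mono hLc.measure_lt_top.ne h1
    have hle : ∫ y : H, p y ≤ volume.real {y : H | M y ≤ 1} := by
      rw [← integral_indicator_one hKc.measurableSet]
      refine integral_mono_of_nonneg (Eventually.of_forall fun y => hp0 _) ?_
        (Eventually.of_forall fun y => ?_)
      · rw [integrable_indicator_iff hKc.measurableSet]
        exact integrableOn_const hKc.measure_lt_top.ne
      · by_cases hy : M y ≤ 1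
        · have : y ∈ {y : H | M y ≤ 1} := hy
          simp only [indicator_of_mem this]
          exact hp1 _
        · have : y ∉ {y : H | M y ≤ 1} := hy
          simp only [indicator_of_notMem this]
          exact (hpt _ (not_le.1 hy)).le
    have hge : volume.real {y : H | N y ≤ 1} ≤ ∫ y : H, q y := by
      rw [← integral_indicator_one hLc.measurableSet]
      refine integral_mono_of_nonneg
        (Eventually.of_forall fun y => indicator_nonneg (fun _ _ => zero_le_one) y) ?_
        (Eventually.of_forall fun y => ?_)
      · have hc : Continuous fun y : H => q y := hqc.comp continuous_subtype_val
        refine hc.integrable_of_hasCompactSupport ?_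
        have hct : IsCompact {y : H | t⁻¹ * N y ≤ 1} :=
          (hNH.const_mul (inv_pos.2 (by linarith : 0 < t))).isSymmetricConvexBody.isCompact
        refine HasCompactSupport.intro hct fun y hy => hqt _ ?_
        rw [mem_ofPred_eq, inv_mul_le_iff₀ (by linarith), mul_one, not_le] at hy
        exact hy
      · by_cases hy : N y ≤ 1
        · have : y ∈ {y : H | N y ≤ 1} := hy
          simp only [indicator_of_mem this]
          exact (hqs _ hy).ge
        · have : y ∉ {y : H | N y ≤ 1} := hy
          simp only [indicator_of_notMem this]
          exact hq0 _
    exact hle.trans (hvol.trans hge)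
  have hwint : ∀ {f : Space κ n → ℝ} {g : 𝓢(Space κ n, ℂ)}, (∀ x, g x = f x) →
      Integrable fun x => (M x ^ κ)⁻¹ * f x := by
    intro f g hg
    have := (hMn.integrable_inv_pow_mul_schwartz volume (lt_finrank_space hn) g).re
    refine this.congr (Eventually.of_forall fun x => ?_)
    simp only [hg, ← Complex.ofReal_mul, RCLike.re_to_complex, Complex.ofReal_re]
  have hpint := hwint hφ
  have hqint := hwint hψ
  -- `w` is the value of M^(-κ) on the boundary of sK, so M^(-κ) - w changes sign exactly there.
  set w := (s ^ κ)⁻¹ with hw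
  have hwpos : 0 < w := by positivity
  have hS1 : MeasurableSet {x | M x ≤ s} := (isClosed_le hMn.continuous continuous_const).measurableSet
  have hS2 : MeasurableSet {x | N x ≤ t} := (isClosed_le hNn.continuous continuous_const).measurableSet
  have hf1 : volume {x | M x ≤ s} ≠ ⊤ := by
    have hct : IsCompact {x | s⁻¹ * M x ≤ 1} :=
      (hMn.const_mul (inv_pos.2 hs0)).isSymmetricConvexBody.isCompact
    simpa only [inv_mul_le_iff₀ hs0, mul_one] using hct.measure_lt_top.ne
  have hf2 : volume {x | N x ≤ t} ≠ ⊤ := by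
    have ht0 : 0 < t := by linarith
    have hct : IsCompact {x | t⁻¹ * N x ≤ 1} :=
      (hNn.const_mul (inv_pos.2 ht0)).isSymmetricConvexBody.isCompact
    simpa only [inv_mul_le_iff₀ ht0, mul_one] using hct.measure_lt_top.ne
  have hi1 : Integrable (indicator {x | M x ≤ s} fun _ => w) := by
    rw [integrable_indicator_iff hS1]; exact integrableOn_const hf1
  have hi2 : Integrable (indicator {x | N x ≤ t} fun _ => w) := by
    rw [integrable_indicator_iff hS2]; exact integrableOn_const hf2
  -- The positive part of M^(-κ) - w separates the two sides. Integrated and combined with `hIq`,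
  -- this gives Vol(sK) ≤ Vol(tL).
  have key : ∀ᵐ x, (M x ^ κ)⁻¹ * q x - indicator {x | N x ≤ t} (fun _ => w) x ≤
      (M x ^ κ)⁻¹ * p x - indicator {x | M x ≤ s} (fun _ => w) x := by
    have h0 : ∀ᵐ x : Space κ n, x ≠ 0 := by simp [ae_iff]
    filter_upwards [h0] with x hx
    have hMx : 0 < M x := hMn.pos x hx
    have h1 : (M x ^ κ)⁻¹ * q x - indicator {x | N x ≤ t} (fun _ => w) x ≤
        max ((M x ^ κ)⁻¹ - w) 0 := by
      by_cases hN : N x ≤ t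
      · have : x ∈ {x | N x ≤ t} := hN
        rw [indicator_of_mem this]
        refine le_max_of_le_left ?_
        have := mul_le_of_le_one_right (inv_nonneg.2 (pow_nonneg hMx.le κ)) (hq1 x)
        linarith
      · have : x ∉ {x | N x ≤ t} := hN
        rw [indicator_of_notMem this, hqt x (not_le.1 hN)]
        simp
    refine h1.trans ?_
    by_cases hs : M x ≤ s
    · have : x ∈ {x | M x ≤ s} := hs
      rw [indicator_of_mem this, hps x hs, mul_one, max_eq_left]
      rw [sub_nonneg]
      exact inv_anti₀ (by positivity) (pow_le_pow_left₀ hMx.le hs κ)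
    · have : x ∉ {x | M x ≤ s} := hs
      rw [indicator_of_notMem this, sub_zero, max_eq_right]
      · exact mul_nonneg (inv_nonneg.2 (pow_nonneg hMx.le κ)) (hp0 x)
      · rw [sub_nonpos]
        exact inv_anti₀ (by positivity) (pow_le_pow_left₀ hs0.le (not_le.1 hs).le κ)
  have hkey := integral_mono_ae (hqint.sub hi2) (hpint.sub hi1) key
  simp only [Pi.sub_apply] at hkey
  rw [integral_sub hqint hi2, integral_sub hpint hi1, integral_indicator_const _ hS1,
    integral_indicator_const _ hS2, smul_eq_mul, smul_eq_mul] at hkey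
  nlinarith

end Sufficiency

/-! ### Homogeneous functions that perturb a norm to a norm. -/

section Tame

variable {E : Type*} [NormedAddCommGroup E] [InnerProductSpace ℝ E]

/-- Positively homogeneous continuous functions `g` for which `C‖x‖ ± g` is subadditive for
some `C`. -/
structure IsTame (g : E → ℝ) : Prop where
  continuous : Continuous g
  smul : ∀ r : ℝ, 0 ≤ r → ∀ x, g (r • x) = r * g x
  defect : ∃ C, ∀ x y, |g x + g y - g (x + y)| ≤ C * (‖x‖ + ‖y‖ - ‖x + y‖)

theorem IsTame.symmetrize {g : E → ℝ} (hg : IsTame g) : IsTame fun x => (g x + g (-x)) / 2 where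
  continuous := by have := hg.continuous; fun_prop
  smul r hr x := by
    rw [← smul_neg, hg.smul r hr, hg.smul r hr]; ring
  defect := by
    obtain ⟨C, hC⟩ := hg.defect
    refine ⟨C, fun x y => ?_⟩
    have h1 := abs_le.1 (hC x y)
    have h2 := hC (-x) (-y)
    rw [← neg_add, norm_neg, norm_neg, norm_neg] at h2
    have h2 := abs_le.1 h2
    rw [abs_le]
    constructor <;> linarith [h1.1, h1.2, h2.1, h2.2]

theorem isTame_norm : IsTame fun x : E => ‖x‖ where
  continuous := continuous_norm
  smul := isNorm_norm.smul
  defect := ⟨1, fun x y => by rw [one_mul, abs_of_nonneg (by linarith [norm_add_le x y])]⟩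

theorem IsTame.add_const_mul {f g : E → ℝ} (hf : IsTame f) (hg : IsTame g) (c : ℝ) :
    IsTame fun x => f x + c * g x where
  continuous := by have := hf.continuous; have := hg.continuous; fun_prop
  smul r hr x := by simp only [hf.smul r hr, hg.smul r hr]; ring
  defect := by
    obtain ⟨C, hC⟩ := hf.defect
    obtain ⟨C', hC'⟩ := hg.defect
    refine ⟨C + |c| * C', fun x y => ?_⟩
    have e : f x + c * g x + (f y + c * g y) - (f (x + y) + c * g (x + y)) =
        (f x + f y - f (x + y)) + c * (g x + g y - g (x + y)) := by ring
    rw [e, add_mul, mul_assoc]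
    refine (abs_add_le _ _).trans (add_le_add (hC x y) ?_)
    rw [abs_mul]
    exact mul_le_mul_of_nonneg_left (hC' x y) (abs_nonneg c)

/-- First-order Taylor estimate on the unit sphere with constant `C`. -/
def HasTaylorBound (C : ℝ) (u : sphere (0 : E) 1 → ℝ) : Prop :=
  ∀ x : sphere (0 : E) 1, ∃ a : E, ‖a‖ ≤ C ∧
    ∀ y : sphere (0 : E) 1, |u y - u x - inner ℝ a ((y : E) - x)| ≤ C * ‖(y : E) - x‖ ^ 2

/-- The product rule supplies the gradient. The extra remainder is the product of the two
increments; as chords have length at most 2, each increment is at most 3 times its constant times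
the chord, whence the 9. -/
theorem HasTaylorBound.mul {C C' U V : ℝ} {u v : sphere (0 : E) 1 → ℝ} (hu : HasTaylorBound C u)
    (hv : HasTaylorBound C' v) (hU : ∀ x, |u x| ≤ U) (hV : ∀ x, |v x| ≤ V) :
    HasTaylorBound (U * C' + V * C + 9 * (C * C')) (fun x => u x * v x) := by
  intro x
  obtain ⟨a, ha, hau⟩ := hu x
  obtain ⟨b, hb, hbv⟩ := hv x
  have hC : 0 ≤ C := (norm_nonneg a).trans ha
  have hC' : 0 ≤ C' := (norm_nonneg b).trans hb
  have hU0 : 0 ≤ U := (abs_nonneg _).trans (hU x)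
  have hV0 : 0 ≤ V := (abs_nonneg _).trans (hV x)
  refine ⟨u x • b + v x • a, ?_, fun y => ?_⟩
  · refine (norm_add_le _ _).trans ?_
    rw [norm_smul, norm_smul, Real.norm_eq_abs, Real.norm_eq_abs]
    have h1 := mul_le_mul (hU x) hb (norm_nonneg _) hU0
    have h2 := mul_le_mul (hV x) ha (norm_nonneg _) hV0
    nlinarith [mul_nonneg hC hC']
  · set h := (y : E) - x with hh
    have hh2 : ‖h‖ ≤ 2 := by
      have := norm_sub_le (y : E) (x : E)
      simp only [norm_eq_of_mem_sphere] at this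
      linarith
    have lip : ∀ {c : E} {K : ℝ} {w : sphere (0 : E) 1 → ℝ}, 0 ≤ K → ‖c‖ ≤ K →
        |w y - w x - inner ℝ c h| ≤ K * ‖h‖ ^ 2 → |w y - w x| ≤ 3 * K * ‖h‖ := by
      intro c K w hK hc hw
      have h1 : |inner ℝ c h| ≤ K * ‖h‖ :=
        (abs_real_inner_le_norm c h).trans (mul_le_mul_of_nonneg_right hc (norm_nonneg _))
      have h2 : |w y - w x| ≤ |w y - w x - inner ℝ c h| + |inner ℝ c h| := by
        simpa using abs_add_le (w y - w x - inner ℝ c h) (inner ℝ c h)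
      have h3 : K * ‖h‖ ^ 2 ≤ 2 * K * ‖h‖ := by
        nlinarith [mul_nonneg hK (norm_nonneg h)]
      linarith
    have e : u y * v y - u x * v x - inner ℝ (u x • b + v x • a) h =
        u x * (v y - v x - inner ℝ b h) + v x * (u y - u x - inner ℝ a h) +
          (u y - u x) * (v y - v x) := by
      rw [inner_add_left, inner_smul_left, inner_smul_left]
      simp only [conj_trivial]
      ring
    rw [e]
    refine (abs_add_le _ _).trans ((add_le_add_left (abs_add_le _ _) _).trans ?_)
    rw [abs_mul, abs_mul, abs_mul]
    have h1 := mul_le_mul (hU x) (hbv y) (abs_nonneg _) hU0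
    have h2 := mul_le_mul (hV x) (hau y) (abs_nonneg _) hV0
    have h3 := mul_le_mul (lip hC ha (hau y)) (lip hC' hb (hbv y)) (abs_nonneg _) (by positivity)
    nlinarith

variable (E) in
/-- The algebra of functions on the sphere with a first-order Taylor estimate. -/
def taylorSubalgebra [FiniteDimensional ℝ E] : Subalgebra ℝ C(sphere (0 : E) 1, ℝ) where
  carrier := {u | ∃ C, HasTaylorBound C u}
  mul_mem' := by
    rintro u v ⟨C, hu⟩ ⟨C', hv⟩
    exact ⟨_, hu.mul hv (fun x => u.norm_coe_le_norm x) (fun x => v.norm_coe_le_norm x)⟩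
  add_mem' := by
    rintro u v ⟨C, hu⟩ ⟨C', hv⟩
    refine ⟨C + C', fun x => ?_⟩
    obtain ⟨a, ha, hau⟩ := hu x
    obtain ⟨b, hb, hbv⟩ := hv x
    refine ⟨a + b, (norm_add_le _ _).trans (add_le_add ha hb), fun y => ?_⟩
    have e : (u + v) y - (u + v) x - inner ℝ (a + b) ((y : E) - x) =
        (u y - u x - inner ℝ a ((y : E) - x)) + (v y - v x - inner ℝ b ((y : E) - x)) := by
      rw [inner_add_left]; simp only [ContinuousMap.add_apply]; ring
    rw [e, add_mul]
    exact (abs_add_le _ _).trans (add_le_add (hau y) (hbv y))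
  algebraMap_mem' r := ⟨0, fun x => ⟨0, by simp, fun y => by simp⟩⟩

/-- Linear functions have zero Taylor remainder, and ⟨x - y, ·⟩ separates x from y. This feeds
Stone–Weierstrass. -/
theorem taylorSubalgebra_separatesPoints [FiniteDimensional ℝ E] :
    (taylorSubalgebra E).SeparatesPoints := by
  intro x y hxy
  let v : E := (x : E) - y
  let u : C(sphere (0 : E) 1, ℝ) := ⟨fun z => inner ℝ v (z : E), by fun_prop⟩
  refine ⟨u, ⟨u, ⟨‖v‖, fun z => ⟨v, le_rfl, fun w => ?_⟩⟩, rfl⟩, fun h => hxy ?_⟩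
  · have : u w - u z - inner ℝ v ((w : E) - z) = 0 := by
      simp only [u, ContinuousMap.coe_mk, inner_sub_right, sub_self]
    rw [this, abs_zero]; positivity
  · have h : inner ℝ v (x : E) = inner ℝ v (y : E) := h
    have h2 : inner ℝ v v = 0 := by
      conv_lhs => rw [show v = (x : E) - y from rfl, inner_sub_right]
      linarith
    have h3 : v = 0 := inner_self_eq_zero.1 h2
    exact Subtype.ext (sub_eq_zero.1 h3)

open Classical in
/-- The extension of a function on the sphere to a positively homogeneous function. -/
def homExt (u : sphere (0 : E) 1 → ℝ) (x : E) : ℝ :=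
  if h : ‖x‖⁻¹ • x ∈ sphere (0 : E) 1 then ‖x‖ * u ⟨‖x‖⁻¹ • x, h⟩ else 0

theorem normalize_mem_sphere {x : E} (hx : x ≠ 0) : ‖x‖⁻¹ • x ∈ sphere (0 : E) 1 := by
  simp [norm_smul, hx]

theorem homExt_of_ne {u : sphere (0 : E) 1 → ℝ} {x : E} (hx : x ≠ 0) :
    homExt u x = ‖x‖ * u ⟨‖x‖⁻¹ • x, normalize_mem_sphere hx⟩ := by
  rw [homExt, dif_pos]

theorem homExt_zero (u : sphere (0 : E) 1 → ℝ) : homExt u 0 = 0 := by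
  rw [homExt, dif_neg]; simp

theorem homExt_coe (u : sphere (0 : E) 1 → ℝ) (θ : sphere (0 : E) 1) : homExt u θ = u θ := by
  rw [homExt_of_ne (ne_zero_of_mem_unit_sphere θ)]
  simp

theorem homExt_smul (u : sphere (0 : E) 1 → ℝ) (r : ℝ) (hr : 0 ≤ r) (x : E) :
    homExt u (r • x) = r * homExt u x := by
  rcases hr.eq_or_lt with rfl | hr
  · simp [homExt_zero]
  by_cases hx : x = 0
  · simp [hx, homExt_zero]
  have hrx : r • x ≠ 0 := smul_ne_zero hr.ne' hx
  have e : ‖r • x‖⁻¹ • r • x = ‖x‖⁻¹ • x := by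
    rw [norm_smul, Real.norm_of_nonneg hr.le, smul_smul, mul_inv, mul_right_comm,
      inv_mul_cancel₀ hr.ne', one_mul]
  have e' : (⟨‖r • x‖⁻¹ • r • x, normalize_mem_sphere hrx⟩ : sphere (0 : E) 1) =
      ⟨‖x‖⁻¹ • x, normalize_mem_sphere hx⟩ := Subtype.ext e
  rw [homExt_of_ne hx, homExt_of_ne hrx, e', norm_smul, Real.norm_of_nonneg hr.le, mul_assoc]

theorem abs_homExt_le {u : sphere (0 : E) 1 → ℝ} {U : ℝ} (hU : ∀ x, |u x| ≤ U) (x : E) :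
    |homExt u x| ≤ U * ‖x‖ := by
  by_cases hx : x = 0
  · simp [hx, homExt_zero]
  · rw [homExt_of_ne hx, abs_mul, abs_norm, mul_comm]
    exact mul_le_mul_of_nonneg_right (hU _) (norm_nonneg _)

theorem continuous_homExt [FiniteDimensional ℝ E] (u : C(sphere (0 : E) 1, ℝ)) :
    Continuous (homExt u) := by
  rw [continuous_iff_continuousAt]
  intro x
  by_cases hx : x = 0
  · subst hx
    rw [ContinuousAt, homExt_zero]
    refine squeeze_zero_norm (fun x => abs_homExt_le (fun y => u.norm_coe_le_norm y) x) ?_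
    have : Continuous fun x : E => ‖u‖ * ‖x‖ := by fun_prop
    simpa using this.tendsto 0
  · have hopen : IsOpen ({0}ᶜ : Set E) := isOpen_compl_singleton
    refine ContinuousOn.continuousAt (s := {0}ᶜ) ?_ (hopen.mem_nhds hx)
    rw [continuousOn_iff_continuous_domRestrict]
    have : ({0}ᶜ : Set E).domRestrict (homExt u) =
        fun y : ({0}ᶜ : Set E) => ‖(y : E)‖ * u ⟨‖(y : E)‖⁻¹ • (y : E), normalize_mem_sphere y.2⟩ :=
      funext fun y => homExt_of_ne y.2
    rw [this]
    refine Continuous.mul (by fun_prop) (u.continuous.comp ?_)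
    refine Continuous.subtype_mk (Continuous.smul (Continuous.inv₀ (by fun_prop) ?_) (by fun_prop)) _
    exact fun y => norm_ne_zero_iff.2 y.2

/-- Compare with a linear function ℓ tangent at z = (x+y)/‖x+y‖. Since ‖w - z‖² = 2(1 - ⟨z, w⟩) on
the sphere, the error at v is at most a constant times ‖v‖ - ⟨z, v⟩; adding the errors at x and y
gives ‖x‖ + ‖y‖ - ‖x+y‖. -/
theorem isTame_homExt [FiniteDimensional ℝ E] {u : C(sphere (0 : E) 1, ℝ)}
    (hu : u ∈ taylorSubalgebra E) : IsTame (homExt u) where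
  continuous := continuous_homExt u
  smul := homExt_smul u
  defect := by
    obtain ⟨C, hC⟩ := hu
    refine ⟨3 * |C| + ‖u‖, fun x y => ?_⟩
    have hU : ∀ x, |u x| ≤ ‖u‖ := fun x => u.norm_coe_le_norm x
    by_cases hz : x + y = 0
    · have h1 := abs_homExt_le hU x
      have h2 := abs_homExt_le hU y
      rw [hz, homExt_zero, norm_zero, sub_zero, sub_zero]
      refine (abs_add_le _ _).trans ?_
      nlinarith [abs_nonneg C, norm_nonneg x, norm_nonneg y]
    · set z : sphere (0 : E) 1 := ⟨‖x + y‖⁻¹ • (x + y), normalize_mem_sphere hz⟩ with hzdef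
      obtain ⟨a, ha, hau⟩ := hC z
      have hz1 : ‖(z : E)‖ = 1 := by simp
      have hzxy : x + y = ‖x + y‖ • (z : E) := by
        rw [hzdef, smul_smul, mul_inv_cancel₀ (norm_ne_zero_iff.2 hz), one_smul]
      set c := u z - inner ℝ a (z : E) with hc
      have hcb : |c| ≤ ‖u‖ + |C| := by
        refine (abs_sub _ _).trans (add_le_add (hU z) ?_)
        refine (abs_real_inner_le_norm _ _).trans ?_
        rw [hz1, mul_one]
        exact ha.trans (le_abs_self C)
      -- The term with `c` corrects the value at z; on the sphere ⟨z, ·⟩ varies only to second order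
      -- at z, so the first-order agreement survives.
      let ℓ : E → ℝ := fun v => c * inner ℝ (z : E) v + inner ℝ a v
      have hℓadd : ℓ (x + y) = ℓ x + ℓ y := by
        simp only [ℓ, inner_add_right]; ring
      have hℓz : ℓ (x + y) = homExt u (x + y) := by
        rw [hzxy, homExt_smul _ _ (norm_nonneg _), homExt_coe]
        simp only [ℓ, inner_smul_right, real_inner_self_eq_norm_sq, hz1, hc]
        ring
      have hv : ∀ v : E, |homExt u v - ℓ v| ≤ (3 * |C| + ‖u‖) * (‖v‖ - inner ℝ (z : E) v) := by
        intro v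
        by_cases hv0 : v = 0
        · simp [hv0, homExt_zero, ℓ]
        set w : sphere (0 : E) 1 := ⟨‖v‖⁻¹ • v, normalize_mem_sphere hv0⟩ with hw
        have hw1 : ‖(w : E)‖ = 1 := by simp
        have hvw : v = ‖v‖ • (w : E) := by
          rw [hw, smul_smul, mul_inv_cancel₀ (norm_ne_zero_iff.2 hv0), one_smul]
        have hsq : ‖(w : E) - z‖ ^ 2 = 2 * (1 - inner ℝ (z : E) (w : E)) := by
          rw [norm_sub_sq_real, hw1, hz1, real_inner_comm]; ring
        have hpos : 0 ≤ 1 - inner ℝ (z : E) (w : E) := by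
          nlinarith [sq_nonneg ‖(w : E) - z‖]
        have key : |u w - ℓ w| ≤ (3 * |C| + ‖u‖) * (1 - inner ℝ (z : E) (w : E)) := by
          have h1 := hau w
          have e : u w - ℓ w = (u w - u z - inner ℝ a ((w : E) - z)) +
              c * (1 - inner ℝ (z : E) (w : E)) := by
            simp only [ℓ, hc, inner_sub_right]; ring
          rw [e]
          refine (abs_add_le _ _).trans ?_
          rw [abs_mul, abs_of_nonneg hpos]
          rw [hsq] at h1
          have h2 := mul_le_mul_of_nonneg_right hcb hpos
          have h3 := mul_le_mul_of_nonneg_right (le_abs_self C) hpos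
          nlinarith
        have h1 : homExt u v = ‖v‖ * u w := homExt_of_ne hv0
        have h2 : ℓ v = ‖v‖ * ℓ w := by
          conv_lhs => rw [hvw]
          simp only [ℓ, inner_smul_right]; ring
        have h3 : inner ℝ (z : E) v = ‖v‖ * inner ℝ (z : E) (w : E) := by
          conv_lhs => rw [hvw]
          rw [inner_smul_right]
        rw [h1, h2, h3, ← mul_sub, abs_mul, abs_norm]
        have := mul_le_mul_of_nonneg_left key (norm_nonneg v)
        linarith
      have e : homExt u x + homExt u y - homExt u (x + y) =
          (homExt u x - ℓ x) + (homExt u y - ℓ y) := by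
        rw [← hℓz, hℓadd]; ring
      rw [e]
      refine (abs_add_le _ _).trans ((add_le_add (hv x) (hv y)).trans (le_of_eq ?_))
      have : inner ℝ (z : E) x + inner ℝ (z : E) y = ‖x + y‖ := by
        rw [← inner_add_right]
        conv_lhs => rw [hzxy]
        rw [inner_smul_right, real_inner_self_eq_norm_sq, hz1]; ring
      rw [← this]; ring

end Tame

/-! ### Density of tame functions. -/

section Approximation

variable {κ n : ℕ}

theorem integrable_rot {u : Space κ n → ℝ} (hu : Continuous u) (x : Space κ n) :
    Integrable (fun τ => u (rot n τ x)) (SO.haar κ) :=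
  (hu.comp (continuous_rot_comp continuous_id continuous_const)).integrable_of_hasCompactSupport
    (HasCompactSupport.of_compactSpace _)

theorem IsTame.average {g : Space κ n → ℝ} (hg : IsTame g) : IsTame (average g) where
  continuous := continuous_average hg.continuous
  smul r hr x := by
    simp only [BusemannPetty.average, map_smul, hg.smul r hr, integral_const_mul]
  defect := by
    obtain ⟨C, hC⟩ := hg.defect
    refine ⟨C, fun x y => ?_⟩
    have hi := integrable_rot hg.continuous
    simp only [BusemannPetty.average]
    rw [← integral_add (hi x) (hi y), ← integral_sub (f := fun τ => g (rot n τ x) + g (rot n τ y))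
      ((hi x).add (hi y)) (hi (x + y))]
    rw [← Real.norm_eq_abs]
    refine (norm_integral_le_of_norm_le_const (C := C * (‖x‖ + ‖y‖ - ‖x + y‖))
      (Eventually.of_forall fun τ => ?_)).trans (by simp)
    have := hC (rot n τ x) (rot n τ y)
    rw [← map_add] at this
    simpa only [LinearIsometryEquiv.norm_map, Real.norm_eq_abs] using this

/-- Tame functions approximate all continuous even rotation invariant homogeneous functions. -/
theorem exists_isTame_near {g : Space κ n → ℝ} (hg : Continuous g)
    (hsmul : ∀ r : ℝ, 0 ≤ r → ∀ x, g (r • x) = r * g x) (heven : ∀ x, g (-x) = g x)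
    (hinv : ∀ (τ : SO κ) x, g (rot n τ x) = g x) {ε : ℝ} (hε : 0 < ε) :
    ∃ h : Space κ n → ℝ, IsTame h ∧ (∀ x, h (-x) = h x) ∧
      (∀ (τ : SO κ) x, h (rot n τ x) = h x) ∧ ∀ x, |h x - g x| ≤ ε * ‖x‖ := by
  let u : C(sphere (0 : Space κ n) 1, ℝ) := ⟨fun θ => g θ, hg.comp continuous_subtype_val⟩
  obtain ⟨⟨w, hw⟩, hwu⟩ := ContinuousMap.exists_mem_subalgebra_near_continuousMap_of_separatesPoints
    (taylorSubalgebra (Space κ n)) taylorSubalgebra_separatesPoints u ε hε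
  have hwt := isTame_homExt hw
  have hnear : ∀ x, |homExt w x - g x| ≤ ε * ‖x‖ := by
    intro x
    by_cases hx : x = 0
    · have : g 0 = 0 := by simpa using hsmul 0 le_rfl 0
      simp [hx, homExt_zero, this]
    · have e : g x = ‖x‖ * u ⟨‖x‖⁻¹ • x, normalize_mem_sphere hx⟩ := by
        show g x = ‖x‖ * g (‖x‖⁻¹ • x)
        rw [← hsmul _ (norm_nonneg _), smul_smul, mul_inv_cancel₀ (norm_ne_zero_iff.2 hx), one_smul]
      rw [homExt_of_ne hx, e, ← mul_sub, abs_mul, abs_norm, mul_comm]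
      refine mul_le_mul_of_nonneg_right ?_ (norm_nonneg _)
      exact ((w - u).norm_coe_le_norm _).trans hwu.le
  -- Symmetrizing and averaging fix `g`, so they do not increase the error.
  refine ⟨average fun x => (homExt w x + homExt w (-x)) / 2, hwt.symmetrize.average,
    average_neg fun x => by simp only [neg_neg]; rw [add_comm], fun τ x => average_rot _ τ x,
    fun x => ?_⟩
  have hi := integrable_rot hwt.symmetrize.continuous x
  have e : g x = ∫ τ, g (rot n τ x) ∂(SO.haar κ) := by simp [hinv]
  rw [e, average, ← integral_sub hi (integrable_rot hg x), ← Real.norm_eq_abs]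
  refine (norm_integral_le_of_norm_le_const (C := ε * ‖x‖) (Eventually.of_forall fun τ => ?_)).trans
    (by simp)
  have h1 := abs_le.1 (hnear (rot n τ x))
  have h2 := abs_le.1 (hnear (-rot n τ x))
  rw [heven, norm_neg] at h2
  rw [LinearIsometryEquiv.norm_map] at h1 h2
  rw [Real.norm_eq_abs, abs_le]
  constructor <;> linarith [h1.1, h1.2, h2.1, h2.2]

end Approximation

/-! ### First variation of volume. -/

/-- The tangent line inequality for `s ↦ s⁻ᵏ`. -/
theorem inv_pow_tangent_le {a b : ℝ} (ha : 0 < a) (hb : 0 < b) (k : ℕ) :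
    (a ^ k)⁻¹ + k * ((a - b) * (a ^ (k + 1))⁻¹) ≤ (b ^ k)⁻¹ := by
  -- Bernoulli bounds (a/b)^k from below; then a/b - 1 ≥ 1 - b/a.
  have h1 := one_add_mul_le_pow (a := a / b - 1) (by have := div_pos ha hb; linarith) k
  rw [add_sub_cancel] at h1
  have h2 : 1 - b / a ≤ a / b - 1 := by
    have : a / b - 1 - (1 - b / a) = (a - b) ^ 2 / (a * b) := by
      rw [eq_div_iff (by positivity)]
      field_simp
    have h3 : 0 ≤ (a - b) ^ 2 / (a * b) := by positivity
    linarith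
  have h4 : 1 + (k : ℝ) * (1 - b / a) ≤ (a / b) ^ k :=
    le_trans (by gcongr) h1
  have h5 := mul_le_mul_of_nonneg_right h4 (inv_nonneg.2 (pow_nonneg ha.le k))
  have e1 : (a / b) ^ k * (a ^ k)⁻¹ = (b ^ k)⁻¹ := by
    rw [div_pow]; field_simp
  have e2 : (1 + (k : ℝ) * (1 - b / a)) * (a ^ k)⁻¹ =
      (a ^ k)⁻¹ + k * ((a - b) * (a ^ (k + 1))⁻¹) := by
    rw [pow_succ]; field_simp
  rwa [e1, e2] at h5

theorem IsNorm.continuous_inv_pow {F : Type*} [NormedAddCommGroup F] [NormedSpace ℝ F] {N : F → ℝ} (hN : IsNorm N) (k : ℕ) :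
    Continuous fun θ : sphere (0 : F) 1 => (N θ ^ k)⁻¹ :=
  ((hN.continuous.comp continuous_subtype_val).pow k).inv₀ fun θ =>
    (pow_pos (hN.pos θ (ne_zero_of_mem_unit_sphere θ)) k).ne'

section SphereIntegrals

variable {F : Type*} [NormedAddCommGroup F] [NormedSpace ℝ F] [MeasurableSpace F]
  [FiniteDimensional ℝ F] [BorelSpace F] (μ : Measure F) [μ.IsAddHaarMeasure]

theorem integrable_sphere {u : sphere (0 : F) 1 → ℝ} (hu : Continuous u) :
    Integrable u μ.toSphere := by
  have : ProperSpace F := FiniteDimensional.proper ℝ F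
  exact hu.integrable_of_hasCompactSupport (HasCompactSupport.of_compactSpace _)

/-- First variation of the volume of the unit ball, from below. -/
theorem IsNorm.measureReal_add_le [Nontrivial F] {P Q : F → ℝ} (hP : IsNorm P) (hQ : IsNorm Q) :
    μ.real {x | P x ≤ 1} + ∫ θ : sphere (0 : F) 1,
      (P θ - Q θ) * (P θ ^ (Module.finrank ℝ F + 1))⁻¹ ∂μ.toSphere ≤ μ.real {x | Q x ≤ 1} := by
  set d := Module.finrank ℝ F with hd
  have hd0 : (0 : ℝ) < d := by exact_mod_cast Module.finrank_pos
  have h1 := hP.measureReal_le_one μ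
  have h2 := hQ.measureReal_le_one μ
  rw [← hd] at h1 h2
  have hi : Integrable (fun θ : sphere (0 : F) 1 => (P θ - Q θ) * (P θ ^ (d + 1))⁻¹) μ.toSphere := by
    refine integrable_sphere μ (Continuous.mul ?_ (hP.continuous_inv_pow _))
    exact (hP.continuous.sub hQ.continuous).comp continuous_subtype_val
  have hiP := integrable_sphere μ (hP.continuous_inv_pow d)
  have hiQ := integrable_sphere μ (hQ.continuous_inv_pow d)
  -- Convexity holds globally, so there is no error term and `Q` need not be close to `P`. The
  -- factor d of the tangent cancels that of the polar volume formula.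
  have h3 := integral_mono (hiP.add (hi.const_mul d)) hiQ fun θ =>
    inv_pow_tangent_le (hP.pos θ (ne_zero_of_mem_unit_sphere θ))
      (hQ.pos θ (ne_zero_of_mem_unit_sphere θ)) d
  simp only [Pi.add_apply] at h3
  rw [integral_add hiP (hi.const_mul d), integral_const_mul, ← h1, ← h2, ← mul_add] at h3
  exact le_of_mul_le_mul_left h3 hd0

end SphereIntegrals

/-! ### Perturbing a body under the affirmative answer. -/

section Perturbation

variable {κ n : ℕ} [NeZero κ] {σ : Fin κ → SO κ} {N : Space κ n → ℝ}

theorem nontrivial_sectionSubspace (hn : 2 ≤ n) (hσ : IsOrthogonalSequence σ) {ξ : Space κ n}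
    (hξ : ‖ξ‖ = 1) : Nontrivial (sectionSubspace σ ξ) := by
  refine Module.nontrivial_of_finrank_pos (R := ℝ) ?_
  rw [finrank_sectionSubspace hσ hξ]
  have : 0 < κ := NeZero.pos κ
  have : 2 * κ ≤ n * κ := Nat.mul_le_mul_right κ hn
  omega

/-- The unit balls of P = N + η‖·‖ and Q = P - εg are compared: the hypothesis on sections, via
first variation at `P`, makes the sections of `Q` at least as large as those of `P`. -/
theorem AffirmativeAnswer.integral_nonneg_of_isTame (hA : AffirmativeAnswer n σ) (hn : 2 ≤ n)
    (hσ : IsOrthogonalSequence σ) (hN : IsNorm N) (hNinv : ∀ (τ : SO κ) x, N (rot n τ x) = N x)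
    {η : ℝ} (hη : 0 < η) {g : Space κ n → ℝ} (hg : IsTame g) (heven : ∀ x, g (-x) = g x)
    (hinv : ∀ (τ : SO κ) x, g (rot n τ x) = g x)
    (hsec : ∀ ξ : Space κ n, ‖ξ‖ = 1 → 0 ≤ ∫ θ : sphere (0 : sectionSubspace σ ξ) 1,
      g (θ : sectionSubspace σ ξ) *
        ((N (θ : sectionSubspace σ ξ) + η * ‖((θ : sectionSubspace σ ξ) : Space κ n)‖) ^
          (n * κ - κ + 1))⁻¹ ∂volume.toSphere) :
    0 ≤ ∫ θ : sphere (0 : Space κ n) 1,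
      g θ * ((N θ + η * ‖(θ : Space κ n)‖) ^ (n * κ + 1))⁻¹ ∂volume.toSphere := by
  have := nontrivial_space (κ := κ) hn
  set P : Space κ n → ℝ := fun x => N x + η * ‖x‖ with hPdef
  have hP : IsNorm P := hN.add (isNorm_norm.const_mul hη)
  have hPinv : ∀ (τ : SO κ) x, P (rot n τ x) = P x := fun τ x => by
    simp only [hPdef, hNinv, LinearIsometryEquiv.norm_map]
  obtain ⟨C₀, hC₀⟩ := hg.defect
  set C := |C₀| + 1 with hCdef
  have hCpos : 0 < C := by positivity
  have hC : ∀ x y, |g x + g y - g (x + y)| ≤ C * (‖x‖ + ‖y‖ - ‖x + y‖) := fun x y =>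
    (hC₀ x y).trans (mul_le_mul_of_nonneg_right (by linarith [le_abs_self C₀])
      (by linarith [norm_add_le x y]))
  have hg0 : g 0 = 0 := by simpa using hg.smul 0 le_rfl 0
  -- The defect bound at the pair x, -x, with `g` even.
  have hgb : ∀ x, |g x| ≤ C * ‖x‖ := by
    intro x
    have h := hC x (-x)
    rw [heven, add_neg_cancel, hg0, norm_neg, norm_zero, sub_zero, sub_zero, ← two_mul, ← two_mul,
      abs_mul, abs_two] at h
    linarith
  have hQlow : ∀ ε : ℝ, 0 ≤ ε → ε * C ≤ η → ∀ x, N x ≤ P x - ε * g x := by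
    intro ε hε hεC x
    have h1 := (le_abs_self (g x)).trans (hgb x)
    have h2 := mul_le_mul_of_nonneg_left h1 hε
    have h3 := mul_le_mul_of_nonneg_right hεC (norm_nonneg x)
    simp only [hPdef]
    linarith
  have hQ : ∀ ε : ℝ, 0 ≤ ε → ε * C ≤ η → IsNorm fun x => P x - ε * g x := by
    intro ε hε hεC
    refine ⟨hP.continuous.sub (hg.continuous.const_mul ε), fun r hr x => ?_, fun x => ?_,
      fun x y => ?_, fun x hx => (hN.pos x hx).trans_le (hQlow ε hε hεC x)⟩
    · rw [hP.smul r hr, hg.smul r hr]; ring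
    · rw [hP.neg, heven]
    · have h1 := mul_le_mul_of_nonneg_left ((le_abs_self _).trans (hC x y)) hε
      have h2 := hN.add_le x y
      have h3 := mul_le_mul_of_nonneg_right hεC
        (show 0 ≤ ‖x‖ + ‖y‖ - ‖x + y‖ by linarith [norm_add_le x y])
      simp only [hPdef]
      linarith
  have hpert : ∀ ε : ℝ, 0 < ε → ε * C ≤ η → 0 ≤ ∫ θ : sphere (0 : Space κ n) 1,
      g θ * ((P θ - ε * g θ) ^ (n * κ + 1))⁻¹ ∂volume.toSphere := by
    intro ε hε hεC
    have hQε := hQ ε hε.le hεC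
    have hvol : volume {x | P x ≤ 1} ≤ volume {x | P x - ε * g x ≤ 1} := by
      refine hA _ _ hP.isSymmetricConvexBody ?_ hQε.isSymmetricConvexBody ?_ fun ξ hξ => ?_
      · intro τ x
        rw [hP.gauge_eq, ← rot_apply, hPinv]
      · intro τ x
        rw [hQε.gauge_eq, ← rot_apply]
        simp only [hPinv, hinv]
      · have := nontrivial_sectionSubspace hn hσ hξ
        have h1 := (hP.restrict (sectionSubspace σ ξ)).measureReal_add_le volume
          (hQε.restrict (sectionSubspace σ ξ))
        rw [finrank_sectionSubspace hσ hξ] at h1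
        simp only [sub_sub_cancel, mul_assoc] at h1
        rw [integral_const_mul] at h1
        have h2 := mul_nonneg hε.le (hsec ξ hξ)
        unfold sectionVolume
        refine (ENNReal.toReal_le_toReal ?_ ?_).1 (le_trans (le_add_of_nonneg_right h2) h1)
        · exact (hP.restrict (sectionSubspace σ ξ)).isSymmetricConvexBody.isCompact.measure_lt_top.ne
        · exact (hQε.restrict
            (sectionSubspace σ ξ)).isSymmetricConvexBody.isCompact.measure_lt_top.ne
    have hvol' := ENNReal.toReal_mono hQε.isSymmetricConvexBody.isCompact.measure_lt_top.ne hvol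
    -- The tangent is taken at `Q` this time, which bounds the volume of `P` below. That volume
    -- being at most the one of `Q`, the variation term has a sign; the limit ε → 0 then replaces
    -- `Q` by `P`.
    have h1 := hQε.measureReal_add_le volume hP
    rw [finrank_space] at h1
    have e : ∀ θ : sphere (0 : Space κ n) 1,
        (P θ - ε * g θ - P θ) * ((P θ - ε * g θ) ^ (n * κ + 1))⁻¹ =
        (-ε) * (g θ * ((P θ - ε * g θ) ^ (n * κ + 1))⁻¹) := fun θ => by ring
    simp only [e] at h1
    rw [integral_const_mul] at h1
    simp only [measureReal_def] at h1
    by_contra hneg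
    rw [not_le] at hneg
    have := mul_pos_of_neg_of_neg (neg_lt_zero.2 hε) hneg
    linarith
  obtain ⟨c, hc, hcN⟩ := hN.exists_le
  let ε : ℕ → ℝ := fun j => η / C * (1 / ((j : ℝ) + 1))
  have hεpos : ∀ j, 0 < ε j := fun j => by positivity
  have hεC : ∀ j, ε j * C ≤ η := fun j => by
    have h1 : 1 / ((j : ℝ) + 1) ≤ 1 := by
      rw [div_le_one (by positivity)]; linarith [(Nat.cast_nonneg j : (0 : ℝ) ≤ j)]
    have h2 : ε j * C = η * (1 / ((j : ℝ) + 1)) := by simp only [ε]; field_simp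
    rw [h2]
    exact mul_le_of_le_one_right hη.le h1
  have hε0 : Tendsto ε atTop (𝓝 0) := by
    simpa only [mul_zero] using tendsto_one_div_add_atTop_nhds_zero_nat.const_mul (η / C)
  have hlim : Tendsto (fun j => ∫ θ : sphere (0 : Space κ n) 1,
      g θ * ((P θ - ε j * g θ) ^ (n * κ + 1))⁻¹ ∂volume.toSphere) atTop
      (𝓝 (∫ θ : sphere (0 : Space κ n) 1, g θ * (P θ ^ (n * κ + 1))⁻¹ ∂volume.toSphere)) := by
    refine tendsto_integral_of_dominated_convergence (fun _ => C * (c ^ (n * κ + 1))⁻¹) ?_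
      (integrable_const _) ?_ ?_
    · intro j
      refine Continuous.aestronglyMeasurable (Continuous.mul ?_
        ((hQ (ε j) (hεpos j).le (hεC j)).continuous_inv_pow _))
      exact hg.continuous.comp continuous_subtype_val
    · refine fun j => Eventually.of_forall fun θ => ?_
      have hθ : ‖(θ : Space κ n)‖ = 1 := by simp
      have h1 := hgb θ
      have h2 := (hcN θ).trans (hQlow (ε j) (hεpos j).le (hεC j) θ)
      rw [hθ, mul_one] at h1 h2
      rw [norm_mul, Real.norm_eq_abs, norm_inv, norm_pow,
        Real.norm_of_nonneg (hc.le.trans h2)]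
      have := hc.trans_le h2
      gcongr
    · refine Eventually.of_forall fun θ => ?_
      refine Tendsto.const_mul _ (Tendsto.inv₀ (Tendsto.pow ?_ _) ?_)
      · simpa using tendsto_const_nhds.sub (hε0.mul_const (g θ))
      · exact (pow_pos (hP.pos θ (ne_zero_of_mem_unit_sphere θ)) _).ne'
  exact ge_of_tendsto' hlim fun j => hpert (ε j) (hεpos j) (hεC j)

/-- A tame h within ε‖·‖ of `g` is raised by ε‖·‖: it then dominates `g`, which preserves the
hypothesis on sections, at a cost of at most 2ε‖·‖ in the conclusion. -/
theorem AffirmativeAnswer.integral_nonneg_of_homogeneous (hA : AffirmativeAnswer n σ) (hn : 2 ≤ n)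
    (hσ : IsOrthogonalSequence σ) (hN : IsNorm N) (hNinv : ∀ (τ : SO κ) x, N (rot n τ x) = N x)
    {η : ℝ} (hη : 0 < η) {g : Space κ n → ℝ} (hg : Continuous g)
    (hsmul : ∀ r : ℝ, 0 ≤ r → ∀ x, g (r • x) = r * g x) (heven : ∀ x, g (-x) = g x)
    (hinv : ∀ (τ : SO κ) x, g (rot n τ x) = g x)
    (hsec : ∀ ξ : Space κ n, ‖ξ‖ = 1 → 0 ≤ ∫ θ : sphere (0 : sectionSubspace σ ξ) 1,
      g (θ : sectionSubspace σ ξ) *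
        ((N (θ : sectionSubspace σ ξ) + η * ‖((θ : sectionSubspace σ ξ) : Space κ n)‖) ^
          (n * κ - κ + 1))⁻¹ ∂volume.toSphere) :
    0 ≤ ∫ θ : sphere (0 : Space κ n) 1,
      g θ * ((N θ + η * ‖(θ : Space κ n)‖) ^ (n * κ + 1))⁻¹ ∂volume.toSphere := by
  have hP : IsNorm fun x => N x + η * ‖x‖ := hN.add (isNorm_norm.const_mul hη)
  set B := ∫ θ : sphere (0 : Space κ n) 1,
    ((N θ + η * ‖(θ : Space κ n)‖) ^ (n * κ + 1))⁻¹ ∂volume.toSphere with hB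
  have hB0 : 0 ≤ B := integral_nonneg fun θ => inv_nonneg.2 (pow_nonneg (hP.nonneg θ) _)
  refine le_of_forall_pos_le_add fun δ hδ => ?_
  set ε := δ / (2 * (B + 1)) with hεdef
  have hε : 0 < ε := by positivity
  obtain ⟨h, htame, hheven, hhinv, hnear⟩ := exists_isTame_near hg hsmul heven hinv hε
  have hub : ∀ x, h x + ε * ‖x‖ ≤ g x + 2 * ε * ‖x‖ := fun x => by
    linarith [(abs_le.1 (hnear x)).2]
  have hlb : ∀ x, g x ≤ h x + ε * ‖x‖ := fun x => by
    linarith [(abs_le.1 (hnear x)).1]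
  have htame' := htame.add_const_mul isTame_norm ε
  have key := hA.integral_nonneg_of_isTame hn hσ hN hNinv hη htame'
    (fun x => by rw [hheven, norm_neg])
    (fun τ x => by rw [hhinv, LinearIsometryEquiv.norm_map]) ?_
  · have hi1 : Integrable (fun θ : sphere (0 : Space κ n) 1 =>
        g θ * ((N θ + η * ‖(θ : Space κ n)‖) ^ (n * κ + 1))⁻¹) volume.toSphere :=
      integrable_sphere volume
        ((hg.comp continuous_subtype_val).mul (hP.continuous_inv_pow (n * κ + 1)))
    have hi2 := integrable_sphere volume (hP.continuous_inv_pow (n * κ + 1))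
    have hi3 : Integrable (fun θ : sphere (0 : Space κ n) 1 =>
        (h θ + ε * ‖(θ : Space κ n)‖) * ((N θ + η * ‖(θ : Space κ n)‖) ^ (n * κ + 1))⁻¹)
        volume.toSphere :=
      integrable_sphere volume
        ((htame'.continuous.comp continuous_subtype_val).mul (hP.continuous_inv_pow (n * κ + 1)))
    have h1 := integral_mono hi3 (hi1.add (hi2.const_mul (2 * ε))) fun θ => by
      have hθ : ‖(θ : Space κ n)‖ = 1 := by simp
      have h2 := mul_le_mul_of_nonneg_right (hub θ)
        (inv_nonneg.2 (pow_nonneg (hP.nonneg θ) (n * κ + 1)))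
      rw [add_mul (g _)] at h2
      simpa only [Pi.add_apply, hθ, mul_one] using h2
    simp only [Pi.add_apply] at h1
    rw [integral_add hi1 (hi2.const_mul _), integral_const_mul, ← hB] at h1
    have h3 : 2 * ε * B ≤ δ := by
      have : 2 * ε * (B + 1) = δ := by rw [hεdef]; field_simp
      nlinarith
    linarith
  · intro ξ hξ
    refine (hsec ξ hξ).trans ?_
    have hPH := hP.restrict (sectionSubspace σ ξ)
    have hval : Continuous fun θ : sphere (0 : sectionSubspace σ ξ) 1 =>
        ((θ : sectionSubspace σ ξ) : Space κ n) :=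
      continuous_subtype_val.comp continuous_subtype_val
    refine integral_mono
      (integrable_sphere volume ((hg.comp hval).mul (hPH.continuous_inv_pow (n * κ - κ + 1))))
      (integrable_sphere volume
        ((htame'.continuous.comp hval).mul (hPH.continuous_inv_pow (n * κ - κ + 1))))
      fun θ => ?_
    exact mul_le_mul_of_nonneg_right (hlb _) (inv_nonneg.2 (pow_nonneg (hPH.nonneg θ) _))

/-- If the Busemann–Petty problem has an affirmative answer, functions with nonnegative integrals
over all sections have nonnegative integral against `‖θ‖^{-κ}`. -/
theorem AffirmativeAnswer.integral_mul_inv_pow_nonneg (hA : AffirmativeAnswer n σ) (hn : 2 ≤ n)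
    (hσ : IsOrthogonalSequence σ) (hN : IsNorm N) (hNinv : ∀ (τ : SO κ) x, N (rot n τ x) = N x)
    {f : Space κ n → ℝ} (hf : Continuous fun θ : sphere (0 : Space κ n) 1 => f θ)
    (heven : ∀ x, f (-x) = f x) (hinv : ∀ (τ : SO κ) x, f (rot n τ x) = f x)
    (hsec : ∀ ξ : Space κ n, ‖ξ‖ = 1 → 0 ≤ ∫ θ : sphere (0 : sectionSubspace σ ξ) 1,
      f (θ : sectionSubspace σ ξ) ∂volume.toSphere) :
    0 ≤ ∫ θ : sphere (0 : Space κ n) 1, f θ * (N θ ^ κ)⁻¹ ∂volume.toSphere := by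
  have hκn : κ ≤ n * κ := Nat.le_mul_of_pos_left κ (by omega)
  have hpos : ∀ η : ℝ, 0 < η → 0 ≤ ∫ θ : sphere (0 : Space κ n) 1,
      f θ * ((N θ + η * ‖(θ : Space κ n)‖) ^ κ)⁻¹ ∂volume.toSphere := by
    intro η hη
    set P : Space κ n → ℝ := fun x => N x + η * ‖x‖ with hPdef
    have hP : IsNorm P := hN.add (isNorm_norm.const_mul hη)
    have hPinv : ∀ (τ : SO κ) x, P (rot n τ x) = P x := fun τ x => by
      simp only [hPdef, hNinv, LinearIsometryEquiv.norm_map]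
    -- The exponent cancels the factor P^(-(κn-κ+1)) of the variation on sections, leaving `f`; on
    -- the whole sphere P^(-(κn+1)) leaves f P^(-κ).
    let u : C(sphere (0 : Space κ n) 1, ℝ) := ⟨fun θ => f θ * P θ ^ (n * κ - κ + 1),
      hf.mul ((hP.continuous.comp continuous_subtype_val).pow _)⟩
    have hext : ∀ x, homExt u x =
        ‖x‖ * (f (‖x‖⁻¹ • x) * P (‖x‖⁻¹ • x) ^ (n * κ - κ + 1)) := by
      intro x
      by_cases hx : x = 0
      · simp [hx, homExt_zero]
      · rw [homExt_of_ne hx]; rfl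
    have key := hA.integral_nonneg_of_homogeneous hn hσ hN hNinv hη (continuous_homExt u)
      (homExt_smul u) (fun x => by rw [hext, hext, norm_neg, smul_neg, heven, hP.neg])
      (fun τ x => by
        rw [hext, hext, LinearIsometryEquiv.norm_map, ← map_smul, hinv, hPinv]) ?_
    · refine key.trans (le_of_eq (integral_congr_ae (Eventually.of_forall fun θ => ?_)))
      have hPθ : 0 < P θ := hP.pos θ (ne_zero_of_mem_unit_sphere θ)
      have e : n * κ + 1 = (n * κ - κ + 1) + κ := by omega
      show homExt u θ * (P θ ^ (n * κ + 1))⁻¹ = f θ * (P θ ^ κ)⁻¹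
      rw [homExt_coe, e, pow_add]
      show f θ * P θ ^ (n * κ - κ + 1) * _ = _
      field_simp
    · intro ξ hξ
      refine (hsec ξ hξ).trans (le_of_eq (integral_congr_ae (Eventually.of_forall fun θ => ?_)))
      set x : Space κ n := ((θ : sectionSubspace σ ξ) : Space κ n) with hx
      have hx1 : ‖x‖ = 1 := by
        rw [hx, ← Submodule.coe_norm]; simp
      have hPx : 0 < P x := hP.pos x (by intro h; rw [h, norm_zero] at hx1; norm_num at hx1)
      show f x = homExt u x * (P x ^ (n * κ - κ + 1))⁻¹
      rw [hext, hx1, inv_one, one_smul, one_mul]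
      field_simp
  obtain ⟨c, hc, hcN⟩ := hN.exists_le
  obtain ⟨M, hM⟩ := (isCompact_range hf).isBounded.exists_norm_le
  have hlim : Tendsto (fun j : ℕ => ∫ θ : sphere (0 : Space κ n) 1,
      f θ * ((N θ + 1 / ((j : ℝ) + 1) * ‖(θ : Space κ n)‖) ^ κ)⁻¹ ∂volume.toSphere) atTop
      (𝓝 (∫ θ : sphere (0 : Space κ n) 1, f θ * (N θ ^ κ)⁻¹ ∂volume.toSphere)) := by
    refine tendsto_integral_of_dominated_convergence (fun _ => M * (c ^ κ)⁻¹) ?_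
      (integrable_const _) ?_ ?_
    · intro j
      exact (hf.mul ((hN.add (isNorm_norm.const_mul
        (Nat.one_div_pos_of_nat (n := j)))).continuous_inv_pow κ)).aestronglyMeasurable
    · refine fun j => Eventually.of_forall fun θ => ?_
      have hθ : ‖(θ : Space κ n)‖ = 1 := by simp
      have h1 : ‖f θ‖ ≤ M := hM _ ⟨θ, rfl⟩
      have h2 := hcN θ
      have h3 : 0 < 1 / ((j : ℝ) + 1) := Nat.one_div_pos_of_nat
      rw [hθ, mul_one] at h2 ⊢
      have h4 : c ≤ N θ + 1 / ((j : ℝ) + 1) := by linarith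
      rw [norm_mul, norm_inv, norm_pow, Real.norm_of_nonneg (hc.le.trans h4)]
      have : 0 ≤ M := (norm_nonneg _).trans h1
      have := hc.trans_le h4
      gcongr
    · refine Eventually.of_forall fun θ => ?_
      refine Tendsto.const_mul _ (Tendsto.inv₀ (Tendsto.pow ?_ _) ?_)
      · simpa using tendsto_const_nhds.add
          (tendsto_one_div_add_atTop_nhds_zero_nat.mul_const ‖(θ : Space κ n)‖)
      · exact (pow_pos (hN.pos θ (ne_zero_of_mem_unit_sphere θ)) _).ne'
  exact ge_of_tendsto' hlim fun j => hpos _ Nat.one_div_pos_of_nat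

end Perturbation

/-! ### Representation of positive functionals by measures. -/

section Representation

open scoped CompactlySupported

variable {X : Type*} [TopologicalSpace X] [CompactSpace X] [T2Space X] [MeasurableSpace X]
  [BorelSpace X]

/-- A positive functional on a space of continuous functions containing a positive function is
represented by a measure. The functional and the functions are parametrized by `W`. -/
theorem exists_measure_of_positive {W : Type*} [AddCommGroup W] [Module ℝ W]
    (T : W →ₗ[ℝ] C(X, ℝ)) (Λ : W →ₗ[ℝ] ℝ) (hpos : ∀ w, 0 ≤ T w → 0 ≤ Λ w)
    {w₀ : W} {c : ℝ} (hc : 0 < c) (hw₀ : ∀ x, c ≤ T w₀ x) :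
    ∃ μ : Measure X, IsFiniteMeasure μ ∧ ∀ w, Λ w = ∫ x, T w x ∂μ := by
  -- Positivity at w and -w forces `Λ` to vanish on the kernel of `T`, so `Λ` descends to a
  -- functional on the range.
  have hker : LinearMap.ker T ≤ LinearMap.ker Λ := by
    intro w hw
    rw [LinearMap.mem_ker] at hw ⊢
    refine le_antisymm ?_ (hpos w hw.ge)
    have := hpos (-w) (by rw [map_neg, hw, neg_zero])
    rw [map_neg] at this
    linarith
  let f : C(X, ℝ) →ₗ.[ℝ] ℝ :=
    ⟨LinearMap.range T, (Submodule.liftQ _ Λ hker).comp T.quotKerEquivRange.symm.toLinearMap⟩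
  have hf : ∀ (w : W) (h : T w ∈ f.domain), f ⟨T w, h⟩ = Λ w := by
    intro w h
    show (Submodule.liftQ _ Λ hker) (T.quotKerEquivRange.symm ⟨T w, h⟩) = Λ w
    rw [LinearMap.quotKerEquivRange_symm_apply_image]
    simp
  have hnonneg : ∀ x : f.domain, (x : C(X, ℝ)) ∈ PointedCone.positive ℝ C(X, ℝ) → 0 ≤ f x := by
    rintro ⟨_, w, rfl⟩ h
    exact (hpos w ((PointedCone.mem_positive _ _).1 h)).trans_eq (hf w _).symm
  -- Multiples of `T w₀` dominate every continuous function; this is the condition for the M. Riesz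
  -- extension.
  have hcofinal : ∀ y, ∃ x : f.domain, (x : C(X, ℝ)) + y ∈ PointedCone.positive ℝ C(X, ℝ) := by
    intro y
    refine ⟨⟨T ((‖y‖ / c) • w₀), _, rfl⟩, (PointedCone.mem_positive _ _).2 ?_⟩
    rw [ContinuousMap.le_def]
    intro x
    have h1 : -‖y‖ ≤ y x := (abs_le.1 (y.norm_coe_le_norm x)).1
    have h2 : ‖y‖ ≤ ‖y‖ / c * T w₀ x := by
      rw [div_mul_eq_mul_div, le_div_iff₀ hc]
      exact mul_le_mul_of_nonneg_left (hw₀ x) (norm_nonneg y)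
    simp only [map_smul, ContinuousMap.zero_apply, ContinuousMap.add_apply,
      ContinuousMap.smul_apply, smul_eq_mul]
    linarith
  obtain ⟨g, hgf, hg⟩ := riesz_extension (PointedCone.positive ℝ C(X, ℝ)) f hnonneg hcofinal
  have hgT : ∀ w, g (T w) = Λ w := fun w => (hgf ⟨T w, w, rfl⟩).trans (hf w _)
  let Φ : C_c(X, ℝ) →ₚ[ℝ] ℝ := PositiveLinearMap.mk₀
    { toFun := fun u => g u.toContinuousMap
      map_add' := fun u v => g.map_add u.toContinuousMap v.toContinuousMap
      map_smul' := fun r u => g.map_smul r u.toContinuousMap }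
    (fun u hu => hg _ ((PointedCone.mem_positive _ _).2 hu))
  refine ⟨RealRMK.rieszMeasure Φ, inferInstance, fun w => ?_⟩
  have h1 := RealRMK.integral_rieszMeasure Φ ⟨T w, HasCompactSupport.of_compactSpace _⟩
  exact ((hgT w).symm.trans h1.symm)

end Representation

/-! ### The ray transform on even Schwartz functions. -/

section Functional

variable {E : Type*} [NormedAddCommGroup E] [InnerProductSpace ℝ E]
  [FiniteDimensional ℝ E] [MeasurableSpace E] [BorelSpace E]

open scoped FourierTransform

variable (E) in
/-- The real vector space of even Schwartz functions. -/
def evenSchwartz : Submodule ℝ 𝓢(E, ℂ) where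
  carrier := {φ | ∀ x, φ (-x) = φ x}
  add_mem' := fun {φ ψ} hφ hψ x => by
    have hφ : ∀ x, φ (-x) = φ x := hφ
    have hψ : ∀ x, ψ (-x) = ψ x := hψ
    simp [hφ, hψ]
  zero_mem' := fun x => by simp
  smul_mem' := fun c φ hφ x => by
    have hφ : ∀ x, φ (-x) = φ x := hφ
    simp [hφ]

theorem fourierSchwartz_add (φ ψ : 𝓢(E, ℂ)) :
    fourierSchwartz (φ + ψ) = fourierSchwartz φ + fourierSchwartz ψ := by
  rw [fourierSchwartz, ← SchwartzMap.fourierTransformCLM_apply ℂ, map_add, map_add]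
  rfl

theorem fourierSchwartz_smul (c : ℝ) (φ : 𝓢(E, ℂ)) :
    fourierSchwartz (c • φ) = c • fourierSchwartz φ := by
  rw [fourierSchwartz, ← SchwartzMap.fourierTransformCLM_apply ℝ, map_smul]
  rfl

/-- The real part of the integrals of `t ^ k φ^` along rays, as a function on the sphere. -/
def rayTransform (k : ℕ) : 𝓢(E, ℂ) →ₗ[ℝ] C(sphere (0 : E) 1, ℝ) where
  toFun φ := ⟨fun θ => (rayIntegral k (fourierSchwartz φ) θ).re,
    Complex.continuous_re.comp (continuous_rayIntegral _ _)⟩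
  map_add' φ ψ := by
    ext θ
    simp only [ContinuousMap.coe_mk, ContinuousMap.add_apply, fourierSchwartz_add, rayIntegral,
      add_apply, mul_add]
    rw [integral_add (integrableOn_ray _ _ (by simp)) (integrableOn_ray _ _ (by simp)),
      Complex.add_re]
  map_smul' c φ := by
    ext θ
    simp only [ContinuousMap.coe_mk, ContinuousMap.smul_apply, fourierSchwartz_smul, rayIntegral,
      smul_apply, mul_smul_comm, integral_smul, RingHom.id_apply, Complex.smul_re]

theorem rayTransform_apply (k : ℕ) (φ : 𝓢(E, ℂ)) (θ : sphere (0 : E) 1) :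
    rayTransform k φ θ = (rayIntegral k (fourier φ) θ).re := by
  have : fourier φ = fourierSchwartz φ := funext fun ξ => (fourierSchwartz_apply φ ξ).symm
  rw [this]; rfl

/-- There is an even Schwartz function whose Fourier transform has positive integrals along all
rays. -/
theorem exists_rayTransform_pos (k : ℕ) : ∃ φ ∈ evenSchwartz E, ∃ c, 0 < c ∧
    ∀ θ, c ≤ rayTransform k φ θ := by
  let b : E → ℂ := fun x => (radialBump 1 x : ℂ)
  have hbc : ContDiff ℝ (⊤ : ℕ∞) b := Complex.ofRealCLM.contDiff.comp (contDiff_radialBump 1)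
  have hbs : HasCompactSupport b :=
    (hasCompactSupport_radialBump zero_le_one).comp_left (g := fun r : ℝ => (r : ℂ)) rfl
  let B : 𝓢(E, ℂ) := hbs.toSchwartzMap hbc
  have hB : ∀ x, B x = (radialBump 1 x : ℂ) := fun x => rfl
  have hBeven : ∀ x, B (-x) = B x := fun x => by
    rw [hB, hB]; simp only [radialBump, norm_neg]
  -- With a radial Fourier transform, the ray integral is the same positive number in all
  -- directions.
  set φ : 𝓢(E, ℂ) := 𝓕⁻ B with hφ
  have hFφ : 𝓕 φ = B := FourierTransform.fourier_fourierInv_eq B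
  have heven : ∀ x, φ (-x) = φ x := by
    intro x
    rw [hφ, SchwartzMap.fourierInv_coe, Real.fourierInv_eq', Real.fourierInv_eq',
      ← integral_neg_eq_self]
    refine integral_congr_ae (Eventually.of_forall fun y => ?_)
    simp only [inner_neg_neg, hBeven]
  let q : ℝ → ℝ := fun t => t ^ k * Real.smoothTransition (1 ^ 2 - ((2 * Real.pi)⁻¹ * t) ^ 2)
  have hpi := Real.pi_pos
  have hray : ∀ θ : sphere (0 : E) 1, rayTransform k φ θ = ∫ t in Ioi (0 : ℝ), q t := by
    intro θ
    rw [rayTransform_apply, rayIntegral]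
    have : ∫ t in Ioi (0 : ℝ), ((t ^ k : ℝ) : ℂ) * fourier φ (t • (θ : E)) =
        ∫ t in Ioi (0 : ℝ), ((q t : ℝ) : ℂ) := by
      refine setIntegral_congr_fun measurableSet_Ioi fun t ht => ?_
      have ht : 0 < t := ht
      have hn : ‖(2 * Real.pi)⁻¹ • t • (θ : E)‖ = (2 * Real.pi)⁻¹ * t := by
        rw [norm_smul, norm_smul, Real.norm_of_nonneg ht.le, Real.norm_of_nonneg (by positivity)]
        simp
      simp only [fourier_eq, hFφ, hB, radialBump, hn, q]
      push_cast
      rfl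
    rw [this, integral_complex_ofReal, Complex.ofReal_re]
  have hqc : Continuous q := by
    have := Real.smoothTransition.continuous
    fun_prop
  have hqz : ∀ t, 2 * Real.pi ≤ t → q t = 0 := by
    intro t ht
    have h1 : 1 ≤ (2 * Real.pi)⁻¹ * t := by
      rw [le_inv_mul_iff₀ (by positivity), mul_one]; exact ht
    have : Real.smoothTransition (1 ^ 2 - ((2 * Real.pi)⁻¹ * t) ^ 2) = 0 :=
      Real.smoothTransition.zero_of_nonpos (by nlinarith)
    simp only [q, this, mul_zero]
  have hqi : IntegrableOn q (Ioi 0) := by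
    have h1 : IntegrableOn q (Icc 0 (2 * Real.pi)) := hqc.continuousOn.integrableOn_compact isCompact_Icc
    have h2 : IntegrableOn q (Ioi (2 * Real.pi)) :=
      integrableOn_zero.congr_fun (fun t ht => (hqz t (le_of_lt ht)).symm) measurableSet_Ioi
    refine (h1.union h2).mono_set fun t ht => ?_
    by_cases h : t ≤ 2 * Real.pi
    · exact Or.inl ⟨le_of_lt ht, h⟩
    · exact Or.inr (not_le.1 h)
  refine ⟨φ, heven, ∫ t in Ioi (0 : ℝ), q t, ?_, fun θ => (hray θ).ge⟩
  rw [setIntegral_pos_iff_support_of_nonneg_ae _ hqi]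
  · refine lt_of_lt_of_le ?_ (measure_mono (s := Ioo 0 (2 * Real.pi)) fun t ht => ⟨?_, ht.1⟩)
    · rw [Real.volume_Ioo, ENNReal.ofReal_pos]; linarith
    · have h1 : (2 * Real.pi)⁻¹ * t < 1 := by
        rw [inv_mul_lt_iff₀ (by positivity), mul_one]; exact ht.2
      have h0 : 0 < (2 * Real.pi)⁻¹ * t := mul_pos (by positivity) ht.1
      have : 0 < Real.smoothTransition (1 ^ 2 - ((2 * Real.pi)⁻¹ * t) ^ 2) :=
        Real.smoothTransition.pos_of_pos (by nlinarith)
      exact (mul_pos (pow_pos ht.1 k) this).ne'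
  · filter_upwards [ae_restrict_mem measurableSet_Ioi] with t ht
    have ht : 0 < t := ht
    exact mul_nonneg (pow_nonneg ht.le k) (Real.smoothTransition.nonneg _)

end Functional

/-! ### The affirmative answer implies intersection bodies. -/

section Necessity

variable {κ n : ℕ}

theorem integral_re_of_continuous {X : Type*} [TopologicalSpace X] [CompactSpace X]
    [MeasurableSpace X] [BorelSpace X] (μ : Measure X) [IsFiniteMeasure μ] {f : X → ℂ}
    (hf : Continuous f) : ∫ x, (f x).re ∂μ = (∫ x, f x ∂μ).re :=
  integral_re (hf.integrable_of_hasCompactSupport (HasCompactSupport.of_compactSpace _))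

theorem rayIntegral_compRot (φ : 𝓢(Space κ n, ℂ)) (τ : SO κ) (k : ℕ) (x : Space κ n) :
    rayIntegral k (compRot φ τ) x = rayIntegral k φ (rot n τ x) := by
  simp only [rayIntegral, compRot_apply, map_smul]

theorem continuous_rayIntegral_rot {X : Type*} [TopologicalSpace X] (φ : 𝓢(Space κ n, ℂ)) (k : ℕ)
    {f : X → SO κ} {g : X → Space κ n} (hf : Continuous f) (hg : Continuous g)
    (hg1 : ∀ x, ‖g x‖ = 1) : Continuous fun x => rayIntegral k φ (rot n (f x) (g x)) := by
  let p : X → sphere (0 : Space κ n) 1 := fun x => ⟨rot n (f x) (g x), by simp [hg1]⟩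
  have hp : Continuous p := Continuous.subtype_mk (continuous_rot_comp hf hg) _
  have := Continuous.comp (continuous_rayIntegral φ k) hp
  simpa only [Function.comp_def, p] using this

variable [NeZero κ] {σ : Fin κ → SO κ}

/-- The functional defined by `‖x‖^{-κ}` is positive if the Busemann–Petty problem has an
affirmative answer. -/
theorem AffirmativeAnswer.re_integral_nonneg (hA : AffirmativeAnswer n σ) (hn : 2 ≤ n)
    (hσ : IsOrthogonalSequence σ) {N : Space κ n → ℝ} (hN : IsNorm N)
    (hNinv : ∀ (τ : SO κ) x, N (rot n τ x) = N x) {φ : 𝓢(Space κ n, ℂ)}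
    (heven : ∀ x, φ (-x) = φ x)
    (hφ : ∀ ξ : sphere (0 : Space κ n) 1, 0 ≤ (rayIntegral (κ - 1) (fourier φ) ξ).re) :
    0 ≤ (∫ x, (((N x ^ κ)⁻¹ : ℝ) : ℂ) * φ x).re := by
  have := nontrivial_space (κ := κ) hn
  set m := n * κ - κ with hm
  set u : Space κ n → ℝ := fun x => (rayIntegral (m - 1) φ x).re with hu
  have hSO : Continuous (Function.uncurry fun (θ : sphere (0 : Space κ n) 1) (τ : SO κ) =>
      u (rot n τ θ)) := by
    have := continuous_rayIntegral_rot φ (m - 1)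
      (f := fun q : sphere (0 : Space κ n) 1 × SO κ => q.2) (g := fun q => (q.1 : Space κ n))
      continuous_snd (continuous_subtype_val.comp continuous_fst) (fun q => by simp)
    exact Complex.continuous_re.comp this
  have hfc : Continuous fun θ : sphere (0 : Space κ n) 1 => average u θ := by
    have := continuous_parametric_integral_of_continuous (μ := SO.haar κ) hSO isCompact_univ
    simpa only [Measure.restrict_univ, average] using this
  have hueven : ∀ x, u (-x) = u x := fun x => by
    simp only [hu, rayIntegral, smul_neg, heven]
  have key := hA.integral_mul_inv_pow_nonneg hn hσ hN hNinv hfc (average_neg hueven)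
    (fun τ x => average_rot u τ x) ?_
  -- After the swap each rotation can be moved onto `N`, which is invariant, so the average drops
  -- out.
  · have hsw : ∫ θ : sphere (0 : Space κ n) 1, average u θ * (N θ ^ κ)⁻¹ ∂volume.toSphere =
        ∫ τ, (∫ θ : sphere (0 : Space κ n) 1, u (rot n τ θ) * (N θ ^ κ)⁻¹ ∂volume.toSphere)
          ∂(SO.haar κ) := by
      have hc : Continuous (Function.uncurry fun (θ : sphere (0 : Space κ n) 1) (τ : SO κ) =>
          u (rot n τ θ) * (N θ ^ κ)⁻¹) := by
        have h2 : Continuous fun q : sphere (0 : Space κ n) 1 × SO κ => (N q.1 ^ κ)⁻¹ :=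
          (hN.continuous_inv_pow κ).comp continuous_fst
        exact hSO.mul h2
      rw [← integral_integral_swap_of_hasCompactSupport hc (HasCompactSupport.of_compactSpace _)]
      simp only [average, integral_mul_const]
    have hin : ∀ τ : SO κ, ∫ θ : sphere (0 : Space κ n) 1, u (rot n τ θ) * (N θ ^ κ)⁻¹
        ∂volume.toSphere = (∫ x, (((N x ^ κ)⁻¹ : ℝ) : ℂ) * φ x).re := by
      intro τ
      have h1 : ∫ x, (((N x ^ κ)⁻¹ : ℝ) : ℂ) * compRot φ τ x =
          ∫ x, (((N x ^ κ)⁻¹ : ℝ) : ℂ) * φ x := by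
        rw [← (rot n τ).measurePreserving.integral_comp (rot n τ).toHomeomorph.measurableEmbedding
          (fun x => (((N x ^ κ)⁻¹ : ℝ) : ℂ) * φ x)]
        simp only [compRot_apply, hNinv]
      rw [← h1, hN.integral_inv_pow_mul_schwartz volume (lt_finrank_space hn), finrank_space, ← hm,
        ← integral_re_of_continuous]
      · refine integral_congr_ae (Eventually.of_forall fun θ => ?_)
        simp only [rayIntegral_compRot, Complex.re_ofReal_mul, hu]
        ring
      · refine Continuous.mul ?_ (continuous_rayIntegral _ _)
        exact Complex.continuous_ofReal.comp (hN.continuous_inv_pow κ)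
    rw [hsw] at key
    simpa [hin] using key
  · intro ξ hξ
    set H := sectionSubspace σ ξ with hH
    have hHn : Nontrivial H := nontrivial_sectionSubspace hn hσ hξ
    have hval : Continuous fun θ : sphere (0 : H) 1 => ((θ : H) : Space κ n) :=
      continuous_subtype_val.comp continuous_subtype_val
    have hval1 : ∀ θ : sphere (0 : H) 1, ‖((θ : H) : Space κ n)‖ = 1 := fun θ => by
      rw [← Submodule.coe_norm]; simp
    have hpol : ∀ τ : SO κ, ∫ h : H, φ (rot n τ h) =
        ∫ θ : sphere (0 : H) 1, rayIntegral (m - 1) φ (rot n τ (θ : H)) ∂volume.toSphere := by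
      intro τ
      have hint : Integrable fun h : H => φ (rot n τ h) :=
        (SchwartzMap.compCLMOfAntilipschitz (K := 1) ℝ H.subtypeL.hasTemperateGrowth
          H.subtypeₗᵢ.antilipschitz (compRot φ τ)).integrable
      rw [integral_polar volume hint, finrank_sectionSubspace hσ hξ, ← hm]
      refine integral_congr_ae (Eventually.of_forall fun θ => ?_)
      simp only [rayIntegral, Submodule.coe_smul, map_smul, Complex.real_smul]
    have hc : Continuous (Function.uncurry fun (τ : SO κ) (θ : sphere (0 : H) 1) =>
        rayIntegral (m - 1) φ (rot n τ (θ : H))) :=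
      continuous_rayIntegral_rot φ (m - 1)
        (f := fun q : SO κ × sphere (0 : H) 1 => q.1) (g := fun q => ((q.2 : H) : Space κ n))
        continuous_fst (hval.comp continuous_snd) (fun q => hval1 q.2)
    have hsw := integral_integral_swap_of_hasCompactSupport (μ := SO.haar κ)
      (ν := (volume : Measure H).toSphere) hc (HasCompactSupport.of_compactSpace _)
    -- By polar coordinates on `H`, the right side is (2π)^κ times the integral of the averaged ray
    -- integrals over the sphere of `H`; the left side has nonnegative real part by hypothesis.
    have havg := integral_rayIntegral_fourier_rot hσ hξ heven
    rw [← hH] at havg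
    simp only [hpol] at havg
    rw [hsw] at havg
    have hTc : Continuous fun τ : SO κ => rayIntegral (κ - 1) (fourier φ) (rot n τ ξ) := by
      have : fourier φ = fourierSchwartz φ := funext fun ζ => (fourierSchwartz_apply φ ζ).symm
      rw [this]
      exact continuous_rayIntegral_rot (fourierSchwartz φ) (κ - 1) continuous_id continuous_const
        (fun _ => hξ)
    have h1 : 0 ≤ (∫ τ, rayIntegral (κ - 1) (fourier φ) (rot n τ ξ) ∂(SO.haar κ)).re := by
      rw [← integral_re_of_continuous _ hTc]
      exact integral_nonneg fun τ => hφ ⟨rot n τ ξ, by simp [hξ]⟩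
    have h2 := congrArg Complex.re havg
    rw [Complex.re_ofReal_mul, Complex.re_ofReal_mul] at h2
    have hin : ∀ θ : sphere (0 : H) 1, average u (θ : H) =
        (∫ τ, rayIntegral (m - 1) φ (rot n τ (θ : H)) ∂(SO.haar κ)).re := by
      intro θ
      exact integral_re_of_continuous _
        (continuous_rayIntegral_rot φ (m - 1) continuous_id continuous_const fun _ => hval1 θ)
    have hcθ : Continuous fun θ : sphere (0 : H) 1 =>
        ∫ τ, rayIntegral (m - 1) φ (rot n τ (θ : H)) ∂(SO.haar κ) := by
      have hc' : Continuous (Function.uncurry fun (θ : sphere (0 : H) 1) (τ : SO κ) =>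
          rayIntegral (m - 1) φ (rot n τ (θ : H))) :=
        continuous_rayIntegral_rot φ (m - 1)
          (f := fun q : sphere (0 : H) 1 × SO κ => q.2) (g := fun q => ((q.1 : H) : Space κ n))
          continuous_snd (hval.comp continuous_fst) (fun q => hval1 q.1)
      have := continuous_parametric_integral_of_continuous (μ := SO.haar κ) hc' isCompact_univ
      simpa only [Measure.restrict_univ] using this
    simp only [hin]
    rw [integral_re_of_continuous _ hcθ]
    have hpi : 0 < (2 * Real.pi) ^ κ := by have := Real.pi_pos; positivity
    have h3 := mul_nonneg (sphereMass_pos (κ := κ)).le h1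
    rw [h2] at h3
    exact nonneg_of_mul_nonneg_right h3 hpi

/-- Positivity of φ ↦ Re ∫ ‖x‖_D^(-κ) φ yields a measure representing real parts. -/
theorem isIntersectionBody_of_affirmativeAnswer (hA : AffirmativeAnswer n σ) (hn : 2 ≤ n)
    (hσ : IsOrthogonalSequence σ) {D : Set (Space κ n)} (hD : IsSymmetricConvexBody D)
    (hDinv : IsRotationInvariant D) : IsIntersectionBody κ D := by
  have := nontrivial_space (κ := κ) hn
  have hN : IsNorm (gauge D) := hD.isNorm_gauge
  have hNinv : ∀ (τ : SO κ) x, gauge D (rot n τ x) = gauge D x := fun τ x => by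
    rw [rot_apply]; exact hDinv τ x
  have hint := fun φ => hN.integrable_inv_pow_mul_schwartz volume (lt_finrank_space hn) φ
  let Λ : 𝓢(Space κ n, ℂ) →ₗ[ℝ] ℝ :=
    { toFun := fun φ => (∫ x, (((gauge D x ^ κ)⁻¹ : ℝ) : ℂ) * φ x).re
      map_add' := fun φ ψ => by
        simp only [add_apply, mul_add]
        rw [integral_add (hint φ) (hint ψ), Complex.add_re]
      map_smul' := fun c φ => by
        simp only [smul_apply, mul_smul_comm, integral_smul, RingHom.id_apply,
          Complex.smul_re] }
  have hΛ : ∀ φ, Λ φ = (∫ x, (((gauge D x ^ κ)⁻¹ : ℝ) : ℂ) * φ x).re := fun φ => rfl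
  obtain ⟨φ₀, hφ₀, c, hc, hφ₀c⟩ := exists_rayTransform_pos (E := Space κ n) (κ - 1)
  have hpos : ∀ w : evenSchwartz (Space κ n), 0 ≤ rayTransform (κ - 1) w.1 → 0 ≤ Λ w.1 := by
    rintro ⟨φ, hφ⟩ hpos
    refine hA.re_integral_nonneg hn hσ hN hNinv hφ fun ξ => ?_
    have := (ContinuousMap.le_def.1 hpos) ξ
    rwa [rayTransform_apply] at this
  obtain ⟨μ, hμ, hrep⟩ := exists_measure_of_positive
    ((rayTransform (κ - 1)).comp (evenSchwartz (Space κ n)).subtype)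
    (Λ.comp (evenSchwartz (Space κ n)).subtype) hpos (w₀ := ⟨φ₀, hφ₀⟩) hc hφ₀c
  refine ⟨μ, hμ, fun φ heven => ?_⟩
  have hre : ∀ ψ : 𝓢(Space κ n, ℂ), (∀ x, ψ (-x) = ψ x) →
      (∫ x, (((gauge D x ^ κ)⁻¹ : ℝ) : ℂ) * ψ x).re =
      (∫ ξ : sphere (0 : Space κ n) 1, rayIntegral (κ - 1) (fourier ψ) ξ ∂μ).re := by
    intro ψ hψ
    have h1 := hrep ⟨ψ, hψ⟩
    rw [← integral_re_of_continuous μ (continuous_rayIntegral_fourier ψ (κ - 1))]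
    simp only [LinearMap.comp_apply, Submodule.subtype_apply, rayTransform_apply, hΛ] at h1
    exact h1
  -- Since Re(-iz) = Im z, the identity for -iφ gives the imaginary parts.
  have hψ : ∀ x, ((-Complex.I) • φ) (-x) = ((-Complex.I) • φ) x := fun x => by
    simp [heven]
  have him := hre ((-Complex.I) • φ) hψ
  have e1 : ∫ x, (((gauge D x ^ κ)⁻¹ : ℝ) : ℂ) * ((-Complex.I) • φ) x =
      -Complex.I * ∫ x, (((gauge D x ^ κ)⁻¹ : ℝ) : ℂ) * φ x := by
    rw [← integral_const_mul]
    refine integral_congr_ae (Eventually.of_forall fun x => ?_)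
    simp only [smul_apply, smul_eq_mul]; ring
  have e2 : ∀ x, rayIntegral (κ - 1) (fourier ((-Complex.I) • φ)) x =
      -Complex.I * rayIntegral (κ - 1) (fourier φ) x := by
    intro x
    have : ∀ ζ, fourier ((-Complex.I) • φ) ζ = -Complex.I * fourier φ ζ := by
      intro ζ
      unfold fourier
      rw [← integral_const_mul]
      refine integral_congr_ae (Eventually.of_forall fun x => ?_)
      simp only [smul_apply, smul_eq_mul]; ring
    unfold rayIntegral
    rw [← integral_const_mul]
    refine integral_congr_ae (Eventually.of_forall fun t => ?_)
    simp only [this]; ring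
  simp only [e1, e2] at him
  rw [integral_const_mul] at him
  have hi : ∀ z : ℂ, (-Complex.I * z).re = z.im := fun z => by simp
  rw [hi, hi] at him
  exact Complex.ext (hre φ heven) him

end Necessity

end BusemannPetty

end

theorem theorem3p3 (κ n : ℕ) [NeZero κ] (hn : 2 ≤ n)
    (σ : Fin κ → Matrix.specialOrthogonalGroup (Fin κ) ℝ)
    (hσ : BusemannPetty.IsOrthogonalSequence σ) :
    BusemannPetty.AffirmativeAnswer n σ ↔
      ∀ D : Set (BusemannPetty.Space κ n),
        BusemannPetty.IsSymmetricConvexBody D → BusemannPetty.IsRotationInvariant D →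
          BusemannPetty.IsIntersectionBody κ D :=
  ⟨fun hA _ hD hDinv => BusemannPetty.isIntersectionBody_of_affirmativeAnswer hA hn hσ hD hDinv,
    fun h => BusemannPetty.affirmativeAnswer_of_isIntersectionBody hn hσ h⟩
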